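/- Let $P_n=(P,L)$ be a finite projective plane of order $n$, with point set $P$ and line set $L$. For a coloring $f$ with colors $\{1,\dots,k\}$ of all or of some of the points, the type of a line $\ell$ is the vector $t_{\ell,f}=(|\ell\cap f^{-1}(1)|,\dots,|\ell\cap f^{-1}(k)|)$. A coloring of all points is called legitimate if distinct lines have distinct types. Fix a set $S\subseteq P$ with $\ln n\le|\ell\cap S|\le 11\ln n$ for every line $\ell\in L$. For a partial coloring $f\colon P\setminus S\to\{1,\dots,d\}$, two distinct lines $\ell,\ell'$ form a dangerous pair $\{\ell,\ell'\}$ if $\sum_{i=1}^{d}\bigl|\,|\ell\cap f^{-1}(i)|-|\ell'\cap f^{-1}(i)|\,\bigr|\le 22\ln n$; a point belongs to this pair if it lies on $\ell$ or on $\ell'$. Let $a,b\ge 0$ be integers and let $d=\mathsf d(n,a,b)$ be a number of colors (for instance the least one) for which there is a partial coloring $f\colon P\setminus S\to\{1,\dots,d\}$ such that no point of $S$ belongs to more than $a\cdot b$ dangerous pairs. Then $P_n$ has a legitimate coloring with $$\max\Bigl(d,\ \Bigl\lceil \min_{m\ge 2}\ \frac{m}{m-1}\bigl(m!\,a\,b\,(m-1)\bigr)^{1/m}\Bigr\rceil\Bigr)$$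 colors (not all of which have to be used), where $m$ runs over the integers $\ge 2$. -/

import Mathlib

open Configuration

/-- The type of a line `l` with respect to a colouring `f` of the points with colours
`0, …, k - 1`: the vector whose `i`-th entry is the number of points of `l` of colour `i`. -/
noncomputable def lineType {P L : Type*} [Membership P L] {k : ℕ}
    (f : P → Fin k) (l : L) : Fin k → ℕ :=
  fun i => {p : P | p ∈ l ∧ f p = i}.ncard

/-- A colouring of the points is legitimate if distinct lines have distinct types. -/
def IsLegitimate {P : Type*} (L : Type*) [Membership P L] {k : ℕ} (f : P → Fin k) : Prop :=
  ∀ l₁ l₂ : L, l₁ ≠ l₂ → lineType f l₁ ≠ lineType f l₂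

/-- The type of a line `l` with respect to a partial colouring, defined on the complement of `S`:
only the coloured points are counted. -/
noncomputable def partialLineType {P L : Type*} [Membership P L] {S : Set P} {d : ℕ}
    (f : {p : P // p ∉ S} → Fin d) (l : L) : Fin d → ℕ :=
  fun i => {p : {p : P // p ∉ S} | p.1 ∈ l ∧ f p = i}.ncard

/-- Two lines form a dangerous pair (in a plane of order `n`) if they are distinct and
the `ℓ¹`-distance of their types is at most `22 ln n`. -/
def IsDangerousPair {P L : Type*} [Membership P L] (n : ℕ) {S : Set P} {d : ℕ}
    (f : {p : P // p ∉ S} → Fin d) (l₁ l₂ : L) : Prop :=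
  l₁ ≠ l₂ ∧
    ∑ i, |(partialLineType f l₁ i : ℝ) - (partialLineType f l₂ i : ℝ)| ≤ 22 * Real.log n

/-- The set of dangerous (unordered) pairs to which the point `p` belongs,
that is, for which `p` is on one of the two lines. -/
def dangerousPairsAt {P : Type*} (L : Type*) [Membership P L] (n : ℕ) {S : Set P} {d : ℕ}
    (f : {p : P // p ∉ S} → Fin d) (p : P) : Set (Sym2 L) :=
  {e | ∃ l₁ l₂ : L, e = s(l₁, l₂) ∧ IsDangerousPair n f l₁ l₂ ∧ (p ∈ l₁ ∨ p ∈ l₂)}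

/-- Every line has at least `ln n` and at most `11 ln n` points in `S`. -/
def IsBalancedSet {P : Type*} (L : Type*) [Membership P L] (n : ℕ) (S : Set P) : Prop :=
  ∀ l : L, Real.log n ≤ ({p : P | p ∈ l ∧ p ∈ S}.ncard : ℝ) ∧
    ({p : P | p ∈ l ∧ p ∈ S}.ncard : ℝ) ≤ 11 * Real.log n

/-- `d` colours suffice for a partial colouring of the points outside `S` such that
no point of `S` belongs to more than `a * b` dangerous pairs. -/
def ColorsSuffice {P : Type*} (L : Type*) [Membership P L] (n : ℕ) (S : Set P)
    (a b d : ℕ) : Prop :=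
  ∃ f : {p : P // p ∉ S} → Fin d, ∀ p ∈ S, (dangerousPairsAt L n f p).ncard ≤ a * b

/-- The quantity `min_{m ≥ 2} (m / (m - 1)) * (m! * a * b * (m - 1)) ^ (1 / m)`. -/
noncomputable def entropyBound (a b : ℕ) : ℝ :=
  sInf ((fun m : ℕ => (m : ℝ) / ((m : ℝ) - 1) *
    ((m.factorial : ℝ) * (a : ℝ) * (b : ℝ) * ((m : ℝ) - 1)) ^ (1 / (m : ℝ))) '' {m : ℕ | 2 ≤ m})

open Configuration

/-- An upper bound for the number of colourings of an `n`-set with `k` colours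
in which the numbers of points of each colour are prescribed. -/
noncomputable def typeBound (k n : ℕ) : ℝ :=
  ∏ j ∈ Finset.range n, ((j : ℝ) + 1) / (((j / k : ℕ) : ℝ) + 1)

lemma typeBound_zero (k : ℕ) : typeBound k 0 = 1 := by simp [typeBound]

lemma typeBound_succ (k n : ℕ) :
    typeBound k (n + 1) = typeBound k n * (((n : ℝ) + 1) / (((n / k : ℕ) : ℝ) + 1)) := by
  simp only [typeBound, Finset.prod_range_succ]

lemma typeBound_nonneg (k n : ℕ) : 0 ≤ typeBound k n :=
  Finset.prod_nonneg fun j _ => by positivity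

lemma typeBound_le_factorial (k n : ℕ) : typeBound k n ≤ n.factorial := by
  induction n with
  | zero => simp [typeBound]
  | succ n ih =>
    rw [typeBound_succ, Nat.factorial_succ, mul_comm]
    push_cast
    refine mul_le_mul ?_ ih (typeBound_nonneg k n) (by positivity)
    exact div_le_self (by positivity) (by simp)

open Finset in
/-- The colourings which are prescribed outside `A` and have a prescribed number of points of each
colour in `A`. -/
lemma card_colourings_le {V : Type*} [Fintype V] [DecidableEq V] {k : ℕ} (A : Finset V)
    (c₀ : V → Fin k) (t : Fin k → ℕ) :
    (#{c : V → Fin k | (∀ v ∉ A, c v = c₀ v) ∧ ∀ i, #{v ∈ A | c v = i} = t i} : ℝ)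
      ≤ typeBound k #A := by
  induction h : #A generalizing A c₀ t with
  | zero =>
    obtain rfl := Finset.card_eq_zero.mp h
    rw [typeBound_zero]
    norm_cast
    refine Finset.card_le_one.mpr fun c hc c' hc' => ?_
    simp only [mem_filter, mem_univ, true_and, notMem_empty, not_false_eq_true,
      forall_true_left] at hc hc'
    funext v
    rw [hc.1, hc'.1]
  | succ n ih =>
    set F : Finset (V → Fin k) :=
      {c : V → Fin k | (∀ v ∉ A, c v = c₀ v) ∧ ∀ i, #{v ∈ A | c v = i} = t i} with hF
    rcases F.eq_empty_or_nonempty with h0 | ⟨c, hc⟩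
    · rw [h0]
      simpa using typeBound_nonneg k (n + 1)
    have hcF := hc
    simp only [hF, mem_filter, mem_univ, true_and] at hc
    obtain ⟨i, -, hi⟩ := Finset.exists_lt_card_fiber_of_mul_lt_card_of_maps_to
      (s := A) (t := (univ : Finset (Fin k))) (f := c) (n := n / k) (fun _ _ => mem_univ _)
      (by rw [h, Finset.card_univ, Fintype.card_fin]; exact Nat.lt_succ_of_le (Nat.mul_div_le n k))
    rw [hc.2 i] at hi
    have hdc : t i * #F = ∑ v ∈ A, #{c ∈ F | c v = i} := by
      have := Finset.sum_card_bipartiteAbove_eq_sum_card_bipartiteBelow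
        (s := F) (t := A) (fun (c : V → Fin k) v => c v = i)
      simp only [bipartiteAbove, bipartiteBelow] at this
      rw [← this, Finset.sum_congr rfl (g := fun _ => t i), sum_const, smul_eq_mul, mul_comm]
      intro c hc
      simp only [hF, mem_filter, mem_univ, true_and] at hc
      exact hc.2 i
    have hv : ∀ v ∈ A, (#{c ∈ F | c v = i} : ℝ) ≤ typeBound k n := by
      intro v hv
      refine le_trans ?_ (ih (A.erase v) (Function.update c₀ v i)
        (fun i' => if i' = i then t i' - 1 else t i') (by rw [card_erase_of_mem hv, h]; rfl))
      norm_cast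
      refine card_le_card fun c hc => ?_
      simp only [hF, mem_filter, mem_univ, true_and] at hc ⊢
      obtain ⟨⟨h1, h2⟩, h3⟩ := hc
      refine ⟨fun u hu => ?_, fun i' => ?_⟩
      · by_cases huv : u = v
        · subst huv; simp [h3]
        · rw [Function.update_of_ne huv]
          exact h1 u fun hA => hu (mem_erase.mpr ⟨huv, hA⟩)
      · rw [filter_erase, card_erase_eq_ite, h2]
        simp only [mem_filter, hv, true_and, h3, eq_comm]
    have hreal : (t i : ℝ) * #F ≤ (n + 1) * typeBound k n := by
      calc (t i : ℝ) * #F = ∑ v ∈ A, (#{c ∈ F | c v = i} : ℝ) := by exact_mod_cast hdc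
        _ ≤ ∑ v ∈ A, typeBound k n := sum_le_sum hv
        _ = _ := by simp [h]
    have hti : (((n / k : ℕ) : ℝ) + 1) ≤ t i := by exact_mod_cast hi
    rw [typeBound_succ, mul_div_assoc', le_div_iff₀ (by positivity)]
    calc (#F : ℝ) * (((n / k : ℕ) : ℝ) + 1) ≤ #F * t i := by gcongr
      _ ≤ _ := by linarith

open Finset in
lemma card_agreeing {V : Type*} [Fintype V] [DecidableEq V] {k : ℕ} (A : Finset V)
    (c₀ : V → Fin k) : #{c : V → Fin k | ∀ v ∉ A, c v = c₀ v} = k ^ #A := by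
  have : ({c : V → Fin k | ∀ v ∉ A, c v = c₀ v} : Finset _)
      = Fintype.piFinset fun v => if v ∈ A then univ else {c₀ v} := by
    ext c
    simp only [mem_filter, mem_univ, true_and, Fintype.mem_piFinset]
    refine forall_congr' fun v => ?_
    by_cases h : v ∈ A <;> simp [h]
  rw [this, Fintype.card_piFinset]
  simp only [apply_ite Finset.card, card_univ, Fintype.card_fin, card_singleton]
  rw [Finset.prod_ite]
  simp

open Finset Classical in
/-- If `G` does not depend on the colours of `A`, and at most `B` of the recolourings of `A`
of any given colouring are bad, then at most `B / k ^ #A` of the colourings in `G` are bad. -/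
lemma card_filter_and_mul_le {V : Type*} [Fintype V] {k : ℕ} (A : Finset V)
    (G Bad : (V → Fin k) → Prop) (B : ℝ)
    (hG : ∀ c c', (∀ v ∉ A, c v = c' v) → G c → G c')
    (hB : ∀ c : V → Fin k, (#{c' : V → Fin k | (∀ v ∉ A, c' v = c v) ∧ Bad c'} : ℝ) ≤ B) :
    (#{c | G c ∧ Bad c} : ℝ) * k ^ #A ≤ B * #{c | G c} := by
  have h := Finset.sum_card_bipartiteAbove_eq_sum_card_bipartiteBelow
    (s := ({c | G c} : Finset (V → Fin k))) (t := ({c | G c ∧ Bad c} : Finset (V → Fin k)))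
    (fun c c' => ∀ v ∉ A, c' v = c v)
  have h2 : ∀ c' ∈ ({c | G c ∧ Bad c} : Finset (V → Fin k)),
      #(bipartiteBelow (fun c c' => ∀ v ∉ A, c' v = c v) ({c | G c} : Finset (V → Fin k)) c')
        = k ^ #A := by
    intro c' hc'
    simp only [mem_filter, mem_univ, true_and] at hc'
    rw [← card_agreeing A c']
    congr 1
    ext c
    simp only [bipartiteBelow, mem_filter, mem_univ, true_and]
    exact ⟨fun h v hv => (h.2 v hv).symm,
      fun h => ⟨hG c' c (fun v hv => (h v hv).symm) hc'.1, fun v hv => (h v hv).symm⟩⟩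
  rw [Finset.sum_congr rfl h2, sum_const, smul_eq_mul] at h
  have h' : (#{c | G c ∧ Bad c} : ℝ) * k ^ #A = ∑ c ∈ ({c | G c} : Finset (V → Fin k)),
      (#(bipartiteAbove (fun c c' => ∀ v ∉ A, c' v = c v)
        ({c | G c ∧ Bad c} : Finset (V → Fin k)) c) : ℝ) := by exact_mod_cast h.symm
  rw [h']
  calc _ ≤ ∑ c ∈ ({c | G c} : Finset (V → Fin k)), B := by
        refine sum_le_sum fun c _ => le_trans ?_ (hB c)
        norm_cast
        refine card_le_card fun c' hc' => ?_
        simp only [bipartiteAbove, mem_filter, mem_univ, true_and] at hc' ⊢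
        exact ⟨hc'.2, hc'.1.2⟩
    _ = _ := by rw [sum_const, nsmul_eq_mul, mul_comm]

open Finset Classical in
/-- The number of colourings avoiding all the bad events supported in `X`. -/
noncomputable def avoidingCount {V E : Type*} [Fintype V] {k : ℕ} (U : E → Finset V)
    (Bad : E → (V → Fin k) → Prop) (X : Finset V) : ℝ :=
  #{c : V → Fin k | ∀ e, U e ⊆ X → ¬ Bad e c}

lemma avoidingCount_nonneg {V E : Type*} [Fintype V] {k : ℕ} (U : E → Finset V)
    (Bad : E → (V → Fin k) → Prop) (X : Finset V) : 0 ≤ avoidingCount U Bad X := by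
  unfold avoidingCount; positivity

open Finset Classical in
lemma pow_mul_avoidingCount_le {V E : Type*} [Fintype V] {k : ℕ} {U : E → Finset V}
    {Bad : E → (V → Fin k) → Prop} {β : ℝ} (hβ : 0 ≤ β) {r : ℕ}
    (h : ∀ X : Finset V, #X < r → ∀ p ∉ X,
      β * avoidingCount U Bad X ≤ k * avoidingCount U Bad (insert p X))
    (Y Z : Finset V) (hYZ : Disjoint Y Z) (hr : #(Y ∪ Z) ≤ r) :
    β ^ #Z * avoidingCount U Bad Y ≤ k ^ #Z * avoidingCount U Bad (Y ∪ Z) := by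
  induction Z using Finset.induction_on with
  | empty => simp
  | insert a Z ha ih =>
    rw [Finset.disjoint_insert_right] at hYZ
    have haYZ : a ∉ Y ∪ Z := by simp [ha, hYZ.1]
    rw [union_insert] at hr ⊢
    rw [card_insert_of_notMem haYZ] at hr
    rw [card_insert_of_notMem ha]
    calc β ^ (#Z + 1) * avoidingCount U Bad Y = β * (β ^ #Z * avoidingCount U Bad Y) := by ring
      _ ≤ β * (k ^ #Z * avoidingCount U Bad (Y ∪ Z)) := by
          exact mul_le_mul_of_nonneg_left (ih hYZ.2 (by omega)) hβ
      _ = k ^ #Z * (β * avoidingCount U Bad (Y ∪ Z)) := by ring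
      _ ≤ k ^ #Z * (k * avoidingCount U Bad (insert a (Y ∪ Z))) := by
          exact mul_le_mul_of_nonneg_left (h _ (by omega) a haYZ) (by positivity)
      _ = _ := by ring

open Finset Classical in
/-- The counting form of the local lemma: each colouring of `X` avoiding the bad events
extends to a new point in at least `β` ways, on average. -/
lemma mul_avoidingCount_le {V E : Type*} [Fintype V] [Fintype E] {k m D : ℕ}
    {U : E → Finset V} {Bad : E → (V → Fin k) → Prop} {β B : ℝ} (hβ : 0 < β) (hB : 0 ≤ B)
    (hdep : ∀ e c c', (∀ v ∈ U e, c v = c' v) → Bad e c → Bad e c')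
    (hdeg : ∀ p, #{e | p ∈ U e} ≤ D)
    (hA : ∀ e, ∀ p ∈ U e, ∃ A ⊆ U e, p ∈ A ∧ #A = m + 1 ∧
      ∀ c : V → Fin k, (#{c' : V → Fin k | (∀ v ∉ A, c' v = c v) ∧ Bad e c'} : ℝ) ≤ B)
    (hk : β + D * B / β ^ m ≤ k) (X : Finset V) (p : V) (hp : p ∉ X) :
    β * avoidingCount U Bad X ≤ k * avoidingCount U Bad (insert p X) := by
  induction hr : #X using Nat.strong_induction_on generalizing X p with
  | _ r ih =>
  have hk0 : (0 : ℝ) < k := lt_of_lt_of_le (by positivity) hk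
  have hstep : ∀ e, p ∈ U e → U e ⊆ insert p X →
      (#{c : V → Fin k | (∀ e, U e ⊆ X → ¬ Bad e c) ∧ Bad e c} : ℝ)
        ≤ B / β ^ m / k * avoidingCount U Bad X := by
    intro e hpe hU
    obtain ⟨A, hAU, hpA, hcard, hbad⟩ := hA e p hpe
    set Y := insert p X \ A with hY
    have hYX : Y ⊆ X := by
      intro v hv
      simp only [hY, mem_sdiff, mem_insert] at hv
      rcases hv.1 with rfl | h
      · exact absurd hpA hv.2
      · exact h
    have h1 := card_filter_and_mul_le A (fun c : V → Fin k => ∀ e, U e ⊆ Y → ¬ Bad e c)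
      (Bad e) B (by
        intro c c' hcc hc e' he' hb
        refine hc e' he' (hdep e' c' c (fun v hv => (hcc v ?_).symm) hb)
        exact (mem_sdiff.mp (he' hv)).2) hbad
    have h2 := pow_mul_avoidingCount_le (U := U) (Bad := Bad) hβ.le (r := r)
      (fun Z hZ q hq => ih #Z hZ Z q hq rfl) Y (A.erase p)
      (by
        rw [Finset.disjoint_left]
        intro v hv hv'
        exact (mem_sdiff.mp hv).2 (mem_of_mem_erase hv'))
    have h3 : Y ∪ A.erase p = X := by
      ext v
      simp only [hY, mem_union, mem_sdiff, mem_insert, mem_erase]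
      constructor
      · rintro (⟨rfl | h, h'⟩ | ⟨h, h'⟩)
        · exact absurd hpA h'
        · exact h
        · exact (mem_insert.mp (hU (hAU h'))).resolve_left h
      · intro h
        by_cases hvA : v ∈ A
        · exact Or.inr ⟨fun hvp => hp (hvp ▸ h), hvA⟩
        · exact Or.inl ⟨Or.inr h, hvA⟩
    rw [h3, card_erase_of_mem hpA, hcard] at h2
    have h2 := h2 hr.le
    simp only [Nat.add_sub_cancel] at h2
    rw [hcard] at h1
    have h4 : (#{c : V → Fin k | (∀ e, U e ⊆ X → ¬ Bad e c) ∧ Bad e c} : ℝ)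
        ≤ #{c : V → Fin k | (∀ e, U e ⊆ Y → ¬ Bad e c) ∧ Bad e c} := by
      norm_cast
      refine card_le_card fun c hc => ?_
      simp only [mem_filter, mem_univ, true_and] at hc ⊢
      exact ⟨fun e' he' => hc.1 e' (he'.trans hYX), hc.2⟩
    refine h4.trans ?_
    rw [div_div, div_mul_eq_mul_div, le_div_iff₀ (by positivity)]
    refine le_of_mul_le_mul_right ?_ (pow_pos hk0 m)
    set T : ℝ := (#{c : V → Fin k | (∀ e, U e ⊆ Y → ¬ Bad e c) ∧ Bad e c} : ℝ)
    calc T * (β ^ m * k) * k ^ m = β ^ m * (T * k ^ (m + 1)) := by ring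
      _ ≤ β ^ m * (B * avoidingCount U Bad Y) :=
          mul_le_mul_of_nonneg_left (by rw [avoidingCount]; convert h1; rfl) (by positivity)
      _ = B * (β ^ m * avoidingCount U Bad Y) := by ring
      _ ≤ B * (k ^ m * avoidingCount U Bad X) := mul_le_mul_of_nonneg_left h2 hB
      _ = _ := by ring
  have hcover : avoidingCount U Bad X ≤ avoidingCount U Bad (insert p X)
      + ∑ e with p ∈ U e, B / β ^ m / k * avoidingCount U Bad X := by
    calc avoidingCount U Bad X
        ≤ avoidingCount U Bad (insert p X) + ∑ e with p ∈ U e ∧ U e ⊆ insert p X,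
          (#{c : V → Fin k | (∀ e, U e ⊆ X → ¬ Bad e c) ∧ Bad e c} : ℝ) := by
          unfold avoidingCount
          norm_cast
          refine le_trans (card_le_card ?_) ((card_union_le _ _).trans
            (Nat.add_le_add_left card_biUnion_le _))
          intro c hc
          simp only [mem_filter, mem_univ, true_and, mem_union, mem_biUnion] at hc ⊢
          by_contra! hcon
          obtain ⟨⟨e, heU, heB⟩, h2⟩ := hcon
          refine h2 e ⟨?_, heU⟩ hc heB
          by_contra hpe
          exact hc e (fun v hv => (mem_insert.mp (heU hv)).resolve_left
            fun hvp => hpe (hvp ▸ hv)) heB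
      _ ≤ avoidingCount U Bad (insert p X) + ∑ e with p ∈ U e ∧ U e ⊆ insert p X,
          B / β ^ m / k * avoidingCount U Bad X := by
          gcongr with e he
          simp only [mem_filter, mem_univ, true_and] at he
          exact hstep e he.1 he.2
      _ ≤ _ := by
          refine add_le_add_right ?_ _
          refine sum_le_sum_of_subset_of_nonneg (fun e he => ?_) fun e _ _ => ?_
          · simp only [mem_filter, mem_univ, true_and] at he ⊢
            exact he.1
          · have := avoidingCount_nonneg U Bad X
            positivity
  rw [sum_const, nsmul_eq_mul] at hcover
  have hX0 : 0 ≤ avoidingCount U Bad X := avoidingCount_nonneg U Bad X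
  have hDr : (#{e | p ∈ U e} : ℝ) ≤ D := by exact_mod_cast hdeg p
  have h5 : (#{e | p ∈ U e} : ℝ) * (B / β ^ m / k * avoidingCount U Bad X)
      ≤ D * (B / β ^ m / k * avoidingCount U Bad X) := by gcongr
  have h6 : (k : ℝ) * (D * (B / β ^ m / k * avoidingCount U Bad X))
      = D * B / β ^ m * avoidingCount U Bad X := by field_simp
  have h7 : (k : ℝ) * avoidingCount U Bad X ≤ k * (avoidingCount U Bad (insert p X)
      + D * (B / β ^ m / k * avoidingCount U Bad X)) := by
    gcongr; linarith
  rw [mul_add, h6] at h7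
  nlinarith [mul_le_mul_of_nonneg_right hk hX0]

open Finset Classical in
theorem exists_colouring_avoiding {V E : Type*} [Fintype V] [Fintype E] {k m D : ℕ}
    {U : E → Finset V} {Bad : E → (V → Fin k) → Prop} {β B : ℝ} (hβ : 0 < β) (hB : 0 ≤ B)
    (hdep : ∀ e c c', (∀ v ∈ U e, c v = c' v) → Bad e c → Bad e c')
    (hdeg : ∀ p, #{e | p ∈ U e} ≤ D)
    (hA : ∀ e, ∀ p ∈ U e, ∃ A ⊆ U e, p ∈ A ∧ #A = m + 1 ∧
      ∀ c : V → Fin k, (#{c' : V → Fin k | (∀ v ∉ A, c' v = c v) ∧ Bad e c'} : ℝ) ≤ B)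
    (hk : β + D * B / β ^ m ≤ k) (hne : ∀ e c, Bad e c → (U e).Nonempty) :
    ∃ c, ∀ e, ¬ Bad e c := by
  have hk0 : (0 : ℝ) < k := lt_of_lt_of_le (by positivity) hk
  have h := pow_mul_avoidingCount_le (U := U) (Bad := Bad) hβ.le (r := #(univ : Finset V))
    (fun X _ p hp => mul_avoidingCount_le hβ hB hdep hdeg hA hk X p hp) ∅ univ (by simp) (by simp)
  have h0 : 0 < avoidingCount U Bad ∅ := by
    unfold avoidingCount
    norm_cast
    refine card_pos.mpr ⟨fun _ => ⟨0, by exact_mod_cast hk0⟩, ?_⟩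
    simp only [mem_filter, mem_univ, true_and, subset_empty]
    intro e he hb
    simpa [he] using hne e _ hb
  have h1 : 0 < avoidingCount U Bad (∅ ∪ univ) := by
    by_contra hcon
    have : 0 < β ^ #(univ : Finset V) * avoidingCount U Bad ∅ := by positivity
    nlinarith [pow_pos hk0 #(univ : Finset V)]
  unfold avoidingCount at h1
  norm_cast at h1
  obtain ⟨c, hc⟩ := card_pos.mp h1
  simp only [mem_filter, mem_univ, true_and, empty_union, subset_univ, forall_true_left] at hc
  exact ⟨c, hc⟩

lemma typeBound_mul_succ {k : ℕ} (q : ℕ) :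
    typeBound k (k * (q + 1)) = typeBound k (k * q)
      * ∏ j ∈ Finset.range k, (((k * q : ℕ) : ℝ) + j + 1) / ((q : ℝ) + 1) := by
  rw [mul_add, mul_one]
  unfold typeBound
  rw [Finset.prod_range_add]
  congr 1
  refine Finset.prod_congr rfl fun j hj => ?_
  have hj := Finset.mem_range.mp hj
  rw [Nat.mul_add_div (by omega), Nat.div_eq_of_lt hj]
  push_cast
  simp

lemma typeBound_mul (k q : ℕ) :
    typeBound k (k * q) * (q.factorial : ℝ) ^ k = ((k * q).factorial : ℝ) := by
  induction q with
  | zero => simp [typeBound_zero]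
  | succ q ih =>
    rw [typeBound_mul_succ, Finset.prod_div_distrib, Finset.prod_const, Finset.card_range,
      Nat.factorial_succ, mul_add, mul_one, ← Nat.factorial_mul_ascFactorial,
      Nat.cast_mul (k * q).factorial, ← ih,
      Nat.ascFactorial_eq_prod_range]
    push_cast
    rw [mul_pow]
    have : ((q : ℝ) + 1) ^ k ≠ 0 := by positivity
    have h2 : ∏ j ∈ Finset.range k, ((k : ℝ) * q + j + 1)
        = ∏ j ∈ Finset.range k, ((k : ℝ) * q + 1 + j) :=
      Finset.prod_congr rfl fun j _ => by ring
    rw [h2]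
    field_simp

lemma typeBound_div_pow_antitone {k : ℕ} (hk : 0 < k) :
    Antitone fun n => typeBound k n / (k : ℝ) ^ n := by
  refine antitone_nat_of_succ_le fun n => ?_
  have hk' : (0 : ℝ) < k := by exact_mod_cast hk
  rw [typeBound_succ, pow_succ, div_le_div_iff₀ (by positivity) (by positivity)]
  have h : (n : ℝ) + 1 ≤ k * ((n / k : ℕ) + 1) := by
    exact_mod_cast Nat.lt_mul_div_succ n hk
  have h2 : ((n : ℝ) + 1) / (((n / k : ℕ) : ℝ) + 1) ≤ k := by
    rw [div_le_iff₀ (by positivity)]; exact h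
  calc _ = typeBound k n * (k : ℝ) ^ n * (((n : ℝ) + 1) / (((n / k : ℕ) : ℝ) + 1)) := by ring
    _ ≤ typeBound k n * (k : ℝ) ^ n * k := by
        gcongr
        exact mul_nonneg (typeBound_nonneg k n) (by positivity)
    _ = _ := by ring

/-- The number of ordered pairs of distinct lines of a plane of order `x`. -/
def linePairs (x : ℝ) : ℝ := (x ^ 2 + x + 1) * (x ^ 2 + x)

lemma typeBound_blocks {k q₀ : ℕ} (hk : 0 < k)
    (h0 : ((k * q₀).factorial : ℝ) * linePairs (k * q₀ + (k - 1))
      < 2 * k ^ (k * q₀) * (q₀.factorial : ℝ) ^ k)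
    (hstep : ∀ q : ℕ, q₀ ≤ q → (∏ j ∈ Finset.range k, ((k : ℝ) * q + j + 1))
      * linePairs (k * (q + 1) + (k - 1))
        ≤ (k * ((q : ℝ) + 1)) ^ k * linePairs (k * q + (k - 1)))
    (n : ℕ) (hn : k * q₀ ≤ n) :
    linePairs n * typeBound k n < 2 * (k : ℝ) ^ n := by
  have hk' : (1 : ℝ) ≤ k := by exact_mod_cast hk
  have main : ∀ q, q₀ ≤ q →
      typeBound k (k * q) / (k : ℝ) ^ (k * q) * linePairs (k * q + (k - 1)) < 2 := by
    intro q hq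
    induction q, hq using Nat.le_induction with
    | base =>
      have := typeBound_mul k q₀
      have hf : (0 : ℝ) < (q₀.factorial : ℝ) ^ k := by positivity
      rw [← this] at h0
      rw [div_mul_eq_mul_div, div_lt_iff₀ (by positivity)]
      refine lt_of_mul_lt_mul_right ?_ hf.le
      linarith
    | succ q hq ih =>
      refine lt_of_le_of_lt ?_ ih
      rw [typeBound_mul_succ, Finset.prod_div_distrib, Finset.prod_const, Finset.card_range,
        mul_add k q 1, mul_one, pow_add]
      have h := hstep q hq
      have ht : 0 ≤ typeBound k (k * q) / (k : ℝ) ^ (k * q) :=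
        div_nonneg (typeBound_nonneg _ _) (by positivity)
      rw [mul_pow] at h
      have h3 : (∏ j ∈ Finset.range k, ((k : ℝ) * q + j + 1)) / ((k : ℝ) ^ k * ((q : ℝ) + 1) ^ k)
          * linePairs (k * (q + 1) + (k - 1)) ≤ linePairs (k * q + (k - 1)) := by
        rw [div_mul_eq_mul_div, div_le_iff₀ (by positivity)]
        linarith
      push_cast
      calc _ = typeBound k (k * q) / (k : ℝ) ^ (k * q) *
            ((∏ j ∈ Finset.range k, ((k : ℝ) * q + j + 1)) / ((k : ℝ) ^ k * ((q : ℝ) + 1) ^ k)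
              * linePairs (k * (q + 1) + (k - 1))) := by
              field_simp
        _ ≤ _ := mul_le_mul_of_nonneg_left h3 ht
  have h1 := main (n / k) ((Nat.le_div_iff_mul_le hk).mpr (by rwa [mul_comm] at hn))
  have h2 := typeBound_div_pow_antitone hk (Nat.mul_div_le n k)
  simp only at h2
  have h3 : linePairs n ≤ linePairs (k * (n / k : ℕ) + (k - 1)) := by
    have : (n : ℝ) ≤ k * (n / k : ℕ) + (k - 1) := by
      have : n + 1 ≤ k * (n / k) + k := by
        have := Nat.lt_mul_div_succ n hk
        rw [mul_add, mul_one] at this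
        exact this
      have : (n : ℝ) + 1 ≤ k * (n / k : ℕ) + k := by exact_mod_cast this
      linarith
    unfold linePairs
    gcongr
  have h4 : typeBound k n / (k : ℝ) ^ n * linePairs n < 2 := by
    refine lt_of_le_of_lt ?_ h1
    have : 0 ≤ typeBound k n / (k : ℝ) ^ n := div_nonneg (typeBound_nonneg _ _) (by positivity)
    have : 0 ≤ linePairs n := by unfold linePairs; positivity
    gcongr
    exact div_nonneg (typeBound_nonneg _ _) (by positivity)
  rw [div_mul_eq_mul_div, div_lt_iff₀ (by positivity)] at h4
  linarith

set_option exponentiation.threshold 500 in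
lemma linePairs_mul_typeBound_ten_lt {n : ℕ} (hn : 400 ≤ n) :
    linePairs n * typeBound 10 n < 2 * (10 : ℝ) ^ n := by
  refine typeBound_blocks (k := 10) (q₀ := 40) (by norm_num) ?_ ?_ n (by omega)
  · norm_num [linePairs, Nat.factorial]
  · intro q hq
    obtain ⟨x, rfl⟩ := Nat.exists_eq_add_of_le hq
    rw [← sub_nonneg]
    simp only [Finset.prod_range_succ, Finset.prod_range_zero, linePairs]
    push_cast
    ring_nf
    positivity

lemma linePairs_mul_typeBound_twelve_lt {n : ℕ} (hn : 7 ≤ n) :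
    linePairs n * typeBound 12 n < 2 * (12 : ℝ) ^ n := by
  rcases lt_or_ge n 36 with h | h
  · interval_cases n <;> norm_num [linePairs, typeBound, Finset.prod_range_succ]
  refine typeBound_blocks (k := 12) (q₀ := 3) (by norm_num) ?_ ?_ n (by omega)
  · norm_num [linePairs, Nat.factorial]
  · intro q hq
    obtain ⟨x, rfl⟩ := Nat.exists_eq_add_of_le hq
    rw [← sub_nonneg]
    simp only [Finset.prod_range_succ, Finset.prod_range_zero, linePairs]
    push_cast
    ring_nf
    positivity

/-- The `m`-th term of the entropy bound with `D = a * b` is at most `k`. -/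
def EntropyCond (k D m : ℕ) : Prop :=
  (D : ℝ) * m.factorial * ((m : ℝ) - 1) ≤ (((m : ℝ) - 1) * k / m) ^ m

lemma entropyTerm_le_iff {a b m : ℕ} (hm : 2 ≤ m) {x : ℝ} (hx : 0 ≤ x) :
    (m : ℝ) / ((m : ℝ) - 1) *
      ((m.factorial : ℝ) * (a : ℝ) * (b : ℝ) * ((m : ℝ) - 1)) ^ (1 / (m : ℝ)) ≤ x ↔
    ((a * b : ℕ) : ℝ) * m.factorial * ((m : ℝ) - 1) ≤ (((m : ℝ) - 1) * x / m) ^ m := by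
  have hm' : (2 : ℝ) ≤ m := by exact_mod_cast hm
  have h1 : (0 : ℝ) < (m : ℝ) - 1 := by linarith
  have h0 : 0 ≤ (m.factorial : ℝ) * (a : ℝ) * (b : ℝ) * ((m : ℝ) - 1) := by positivity
  have h2 : 0 ≤ ((m : ℝ) - 1) * x / m := by positivity
  have h3 : ((a * b : ℕ) : ℝ) * m.factorial * ((m : ℝ) - 1)
      = (m.factorial : ℝ) * (a : ℝ) * (b : ℝ) * ((m : ℝ) - 1) := by push_cast; ring
  rw [h3, div_mul_eq_mul_div, div_le_iff₀ h1, ← le_div_iff₀' (by linarith), mul_comm x,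
    one_div, Real.rpow_inv_le_iff_of_pos h0 h2 (by linarith), Real.rpow_natCast]

lemma exists_entropyCond {a b k : ℕ} (h : ⌈entropyBound a b⌉₊ ≤ k) :
    ∃ m, 2 ≤ m ∧ EntropyCond k (a * b) m := by
  have hb : entropyBound a b ≤ k := Nat.ceil_le.mp h
  rcases Nat.eq_zero_or_pos (a * b) with h0 | h0
  · refine ⟨2, le_rfl, ?_⟩
    rw [EntropyCond, h0]
    norm_num
    positivity
  by_contra! hcon
  set g : ℕ → ℝ := fun m => (m : ℝ) / ((m : ℝ) - 1) *
    ((m.factorial : ℝ) * (a : ℝ) * (b : ℝ) * ((m : ℝ) - 1)) ^ (1 / (m : ℝ)) with hg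
  have hgt : ∀ m, 2 ≤ m → (k : ℝ) < g m := by
    intro m hm
    by_contra! hle
    exact hcon m hm ((entropyTerm_le_iff hm (by positivity)).mp hle)
  have hev : ∀ᶠ m : ℕ in Filter.atTop, ((k : ℝ) + 1) ^ m / m.factorial < 1 :=
    (FloorSemiring.tendsto_pow_div_factorial_atTop ((k : ℝ) + 1)).eventually_lt_const one_pos
  obtain ⟨M, hM⟩ := Filter.eventually_atTop.mp hev
  have hlarge : ∀ m, 2 ≤ m → M ≤ m → (k : ℝ) + 1 ≤ g m := by
    intro m hm hMm
    by_contra! hlt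
    have h1 := (entropyTerm_le_iff hm (by positivity)).mp hlt.le
    have h2 := hM m hMm
    rw [div_lt_one (by positivity)] at h2
    have hm' : (2 : ℝ) ≤ m := by exact_mod_cast hm
    have h3 : (((m : ℝ) - 1) * (k + 1) / m) ^ m ≤ ((k : ℝ) + 1) ^ m := by
      apply pow_le_pow_left₀
      · have : (0 : ℝ) ≤ (m : ℝ) - 1 := by linarith
        positivity
      · rw [div_le_iff₀ (by positivity)]
        nlinarith
    have h4 : (1 : ℝ) ≤ (a * b : ℕ) := by exact_mod_cast h0
    have h5 : (0 : ℝ) < m.factorial := by positivity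
    have h6 : (m.factorial : ℝ) ≤ (a * b : ℕ) * m.factorial * ((m : ℝ) - 1) := by
      nlinarith [mul_le_mul_of_nonneg_right h4 h5.le]
    linarith
  have hfin : ∃ x : ℝ, (k : ℝ) < x ∧ ∀ m ∈ Finset.Ico 2 M, x ≤ g m := by
    rcases (Finset.Ico 2 M).eq_empty_or_nonempty with he | hne
    · exact ⟨k + 1, by linarith, by simp [he]⟩
    · obtain ⟨m, hm, hmin⟩ := Finset.exists_min_image _ g hne
      exact ⟨g m, hgt m (Finset.mem_Ico.mp hm).1, hmin⟩
  obtain ⟨x, hx, hxg⟩ := hfin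
  have : min x (k + 1) ≤ entropyBound a b := by
    refine le_csInf ⟨_, 2, le_refl 2, rfl⟩ ?_
    rintro _ ⟨m, hm, rfl⟩
    rcases lt_or_ge m M with h | h
    · exact (min_le_left _ _).trans (hxg m (Finset.mem_Ico.mpr ⟨hm, h⟩))
    · exact (min_le_right _ _).trans (hlarge m hm h)
  have : (k : ℝ) < min x (k + 1) := lt_min hx (by linarith)
  linarith

lemma EntropyCond.of_succ {k D m : ℕ} (hm : 2 ≤ m) (hk : k * m ≤ (m + 1) ^ 2)
    (h : EntropyCond k D (m + 1)) : EntropyCond k D m := by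
  unfold EntropyCond at *
  have hm' : (2 : ℝ) ≤ m := by exact_mod_cast hm
  have hm0 : (0 : ℝ) < m := by linarith
  have hm1 : (0 : ℝ) < (m : ℝ) - 1 := by linarith
  have hk' : (k : ℝ) * m ≤ (m + 1) ^ 2 := by exact_mod_cast hk
  rw [Nat.factorial_succ] at h
  push_cast at h
  rw [add_sub_cancel_right, pow_succ] at h
  have hbern : 1 - 1 / (m : ℝ) ≤ (((m : ℝ) ^ 2 - 1) / m ^ 2) ^ m := by
    have h1 : (-2 : ℝ) ≤ -(1 / (m : ℝ) ^ 2) := by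
      have : 1 / (m : ℝ) ^ 2 ≤ 1 := by
        rw [div_le_one (by positivity)]; nlinarith
      linarith
    have := one_add_mul_le_pow h1 m
    calc 1 - 1 / (m : ℝ) = 1 + m * -(1 / (m : ℝ) ^ 2) := by field_simp; ring
      _ ≤ (1 + -(1 / (m : ℝ) ^ 2)) ^ m := this
      _ = _ := by congr 1; field_simp; ring
  set X : ℝ := ((m : ℝ) * k / (m + 1)) ^ m with hX
  have hX0 : 0 ≤ X := by positivity
  have hprod : (((m : ℝ) - 1) * k / m) ^ m = X * (((m : ℝ) ^ 2 - 1) / m ^ 2) ^ m := by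
    rw [hX, ← mul_pow]
    congr 1
    field_simp
    ring
  rw [hprod]
  have h2 : (D : ℝ) * m.factorial ≤ X * (k / (m + 1) ^ 2) := by
    have h3 : (D : ℝ) * m.factorial * ((m + 1) * m) ≤ X * (k / (m + 1) ^ 2) * ((m + 1) * m) := by
      calc (D : ℝ) * m.factorial * ((m + 1) * m) = D * ((m + 1) * m.factorial) * m := by ring
        _ ≤ _ := h
        _ = _ := by field_simp
    exact le_of_mul_le_mul_right h3 (by positivity)
  calc (D : ℝ) * m.factorial * (m - 1) ≤ X * (k / (m + 1) ^ 2) * (m - 1) := by gcongr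
    _ = X * ((k * m / (m + 1) ^ 2) * (1 - 1 / m)) := by field_simp
    _ ≤ X * (1 * (1 - 1 / m)) := by
        have : (0 : ℝ) ≤ 1 - 1 / m := by
          rw [sub_nonneg, div_le_one hm0]; linarith
        gcongr
        rw [div_le_one (by positivity)]
        exact hk'
    _ ≤ _ := by rw [one_mul]; gcongr

lemma EntropyCond.of_ge {k D m₀ m : ℕ} (hm₀ : 2 ≤ m₀) (hk : k ≤ m₀ + 2)
    (hm : m₀ ≤ m) (h : EntropyCond k D m) : EntropyCond k D m₀ := by
  induction m, hm using Nat.le_induction with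
  | base => exact h
  | succ m hm ih =>
    refine ih (EntropyCond.of_succ (hm₀.trans hm) ?_ h)
    calc k * m ≤ (m + 2) * m := Nat.mul_le_mul_right _ (by omega)
      _ ≤ (m + 1) ^ 2 := by nlinarith

lemma EntropyCond.exists_le {k D m₀ m : ℕ} (hm₀ : 2 ≤ m₀) (hk : k ≤ m₀ + 2)
    (hm : 2 ≤ m) (h : EntropyCond k D m) : ∃ m', 2 ≤ m' ∧ m' ≤ m₀ ∧ EntropyCond k D m' := by
  rcases le_total m m₀ with h1 | h1
  · exact ⟨m, hm, h1, h⟩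
  · exact ⟨m₀, hm₀, le_rfl, h.of_ge hm₀ hk h1⟩

lemma EntropyCond.mono {k k' D m : ℕ} (hm : 2 ≤ m) (hk : k ≤ k') (h : EntropyCond k D m) :
    EntropyCond k' D m := by
  have hm' : (2 : ℝ) ≤ m := by exact_mod_cast hm
  have h1 : (0 : ℝ) ≤ (m : ℝ) - 1 := by linarith
  unfold EntropyCond at *
  refine h.trans ?_
  gcongr

lemma EntropyCond.lt_of_seven {D m : ℕ} (hm : 2 ≤ m) (h : EntropyCond 7 D m) : D < 12 := by
  obtain ⟨m', h2, h9, h⟩ := h.exists_le (m₀ := 5) (by norm_num) (by norm_num) hm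
  by_contra! hD
  have hD' : (12 : ℝ) ≤ D := by exact_mod_cast hD
  unfold EntropyCond at h
  interval_cases m' <;> norm_num [Nat.factorial] at h <;> linarith

lemma EntropyCond.lt_of_eight {D m : ℕ} (hm : 2 ≤ m) (h : EntropyCond 8 D m) : D < 25 := by
  obtain ⟨m', h2, h9, h⟩ := h.exists_le (m₀ := 6) (by norm_num) (by norm_num) hm
  by_contra! hD
  have hD' : (25 : ℝ) ≤ D := by exact_mod_cast hD
  unfold EntropyCond at h
  interval_cases m' <;> norm_num [Nat.factorial] at h <;> linarith

lemma EntropyCond.lt_of_nine {D m : ℕ} (hm : 2 ≤ m) (h : EntropyCond 9 D m) : D < 54 := by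
  obtain ⟨m', h2, h9, h⟩ := h.exists_le (m₀ := 7) (by norm_num) (by norm_num) hm
  by_contra! hD
  have hD' : (54 : ℝ) ≤ D := by exact_mod_cast hD
  unfold EntropyCond at h
  interval_cases m' <;> norm_num [Nat.factorial] at h <;> linarith

lemma EntropyCond.lt_of_ten {D m : ℕ} (hm : 2 ≤ m) (h : EntropyCond 10 D m) : D < 122 := by
  obtain ⟨m', h2, h9, h⟩ := h.exists_le (m₀ := 8) (by norm_num) (by norm_num) hm
  by_contra! hD
  have hD' : (122 : ℝ) ≤ D := by exact_mod_cast hD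
  unfold EntropyCond at h
  interval_cases m' <;> norm_num [Nat.factorial] at h <;> linarith

lemma EntropyCond.lt_of_eleven {D m : ℕ} (hm : 2 ≤ m) (h : EntropyCond 11 D m) : D < 282 := by
  obtain ⟨m', h2, h9, h⟩ := h.exists_le (m₀ := 9) (by norm_num) (by norm_num) hm
  by_contra! hD
  have hD' : (282 : ℝ) ≤ D := by exact_mod_cast hD
  unfold EntropyCond at h
  interval_cases m' <;> norm_num [Nat.factorial] at h <;> linarith

section Plane

open Finset Classical

lemma lineType_eq_card {P L : Type*} [Membership P L] [Fintype P] {k : ℕ} (f : P → Fin k) (l : L)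
    (i : Fin k) : lineType f l i = #{p : P | p ∈ l ∧ f p = i} := by
  rw [lineType, Set.ncard_eq_toFinset_card', Set.toFinset_ofPred]

lemma IsLegitimate.castLE {P L : Type*} [Membership P L] {k k' : ℕ} {f : P → Fin k}
    (hf : IsLegitimate L f) (h : k ≤ k') : IsLegitimate L fun p => Fin.castLE h (f p) := by
  intro l₁ l₂ hne heq
  refine hf l₁ l₂ hne (funext fun i => ?_)
  have := congrFun heq (Fin.castLE h i)
  simpa only [lineType, Fin.castLE_inj] using this

/-- The colouring `c` on `S`, and `h` elsewhere. -/
noncomputable def overlay {P : Type*} {k : ℕ} (S : Set P) (h c : P → Fin k) : P → Fin k :=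
  fun p => if p ∈ S then c p else h p

/-- If only the colours of points of `A ⊆ l₁ \ l₂` may be changed, then few of the
colourings give the same type to `l₁` and `l₂`. -/
lemma card_sameType_le {P L : Type*} [Membership P L] [Fintype P] {k : ℕ} (S : Set P)
    (h : P → Fin k) {l₁ l₂ : L} (A : Finset P) (hA : ∀ p ∈ A, p ∈ S ∧ p ∈ l₁ ∧ p ∉ l₂)
    (c : P → Fin k) :
    (#{c' : P → Fin k | (∀ v ∉ A, c' v = c v) ∧
      lineType (overlay S h c') l₁ = lineType (overlay S h c') l₂} : ℝ) ≤ typeBound k #A := by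
  refine le_trans ?_ (card_colourings_le A c fun i => lineType (overlay S h c) l₂ i
    - #{p : P | p ∈ l₁ ∧ p ∉ A ∧ overlay S h c p = i})
  norm_cast
  refine card_le_card fun c' hc' => ?_
  simp only [mem_filter, mem_univ, true_and] at hc' ⊢
  obtain ⟨hoff, htype⟩ := hc'
  refine ⟨hoff, fun i => ?_⟩
  have hov : ∀ p ∉ A, overlay S h c' p = overlay S h c p := by
    intro p hp
    simp only [overlay, hoff p hp]
  have h2 : lineType (overlay S h c') l₂ i = lineType (overlay S h c) l₂ i := by
    rw [lineType_eq_card, lineType_eq_card]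
    congr 1
    refine filter_congr fun p _ => and_congr_right fun hp => ?_
    rw [hov p fun hpA => (hA p hpA).2.2 hp]
  have h1 : lineType (overlay S h c') l₁ i
      = #{v ∈ A | c' v = i} + #{p : P | p ∈ l₁ ∧ p ∉ A ∧ overlay S h c p = i} := by
    rw [lineType_eq_card, ← card_union_of_disjoint]
    · congr 1
      ext p
      simp only [mem_filter, mem_univ, true_and, mem_union]
      by_cases hp : p ∈ A
      · simp [hp, (hA p hp).2.1, overlay, (hA p hp).1]
      · simp [hp, hov p hp]
    · rw [Finset.disjoint_left]
      intro p hp hp'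
      simp only [mem_filter, mem_univ, true_and] at hp hp'
      exact hp'.2.1 hp.1
  have := congrFun htype i
  rw [h1, h2] at this
  omega

variable {P L : Type*} [Membership P L] [Fintype P] [Fintype L] [ProjectivePlane P L]

variable (L) in
lemma card_linesThrough (p : P) : #{l : L | p ∈ l} = ProjectivePlane.order P L + 1 := by
  rw [← ProjectivePlane.lineCount_eq L p, lineCount, Nat.card_eq_fintype_card, Fintype.card_subtype]

variable (P) in
lemma card_pointsOn (l : L) : #{p : P | p ∈ l} = ProjectivePlane.order P L + 1 := by
  rw [← ProjectivePlane.pointCount_eq P l, pointCount, Nat.card_eq_fintype_card,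
    Fintype.card_subtype]

omit [Fintype P] in
lemma card_linesThrough_two {p q : P} (h : p ≠ q) : #{l : L | p ∈ l ∧ q ∈ l} = 1 := by
  rw [Finset.card_eq_one]
  refine ⟨HasLines.mkLine h, ?_⟩
  ext l
  simp only [mem_filter, mem_univ, true_and, mem_singleton]
  have hax := HasLines.mkLine_ax (L := L) h
  constructor
  · exact fun hl => (Nondegenerate.eq_or_eq hl.1 hl.2 hax.1 hax.2).resolve_left h
  · rintro rfl; exact hax

omit [Fintype L] in
lemma card_commonPoints {l₁ l₂ : L} (h : l₁ ≠ l₂) : #{p : P | p ∈ l₁ ∧ p ∈ l₂} = 1 := by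
  rw [Finset.card_eq_one]
  refine ⟨HasPoints.mkPoint h, ?_⟩
  ext p
  simp only [mem_filter, mem_univ, true_and, mem_singleton]
  have hax := HasPoints.mkPoint_ax (P := P) h
  constructor
  · exact fun hp => (Nondegenerate.eq_or_eq hp.1 hax.1 hp.2 hax.2).resolve_right h
  · rintro rfl; exact hax

omit [Fintype L] in
lemma card_sub_one_le_card_diff (S : Set P) {l₁ l₂ : L} (h : l₁ ≠ l₂) :
    #{p : P | p ∈ S ∧ p ∈ l₁} ≤ #{p : P | p ∈ S ∧ p ∈ l₁ ∧ p ∉ l₂} + 1 := by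
  rw [← card_commonPoints (P := P) h]
  refine le_trans (card_le_card fun p hp => ?_) (card_union_le _ _)
  simp only [mem_filter, mem_univ, true_and, mem_union] at hp ⊢
  tauto

theorem exists_isLegitimate_of_linePairs_lt {n k : ℕ} (hn : ProjectivePlane.order P L = n)
    (hk : 0 < k) (h : linePairs n * typeBound k n < 2 * (k : ℝ) ^ n) :
    ∃ f : P → Fin k, IsLegitimate L f := by
  by_contra! hcon
  have : Nonempty (Fin k) := ⟨⟨0, hk⟩⟩
  obtain ⟨h₀⟩ : Nonempty (P → Fin k) := inferInstance
  set O : Finset (L × L) := univ.offDiag with hO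
  have hbad : ∀ e ∈ O, (#{c : P → Fin k | lineType c e.1 = lineType c e.2} : ℝ) * (k : ℝ) ^ n
      ≤ typeBound k n * (k : ℝ) ^ Fintype.card P := by
    intro e he
    simp only [hO, mem_offDiag, mem_univ, true_and] at he
    obtain ⟨A, hAsub, hAcard⟩ := Finset.exists_subset_card_eq
      (s := ({p : P | p ∈ Set.univ ∧ p ∈ e.1 ∧ p ∉ e.2} : Finset P)) (n := n) (by
        have := card_sub_one_le_card_diff (Set.univ : Set P) he
        simp only [Set.mem_univ, true_and] at this ⊢
        rw [card_pointsOn, hn] at this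
        omega)
    have key := card_filter_and_mul_le A (fun _ : P → Fin k => True)
      (fun c => lineType c e.1 = lineType c e.2) (typeBound k n) (fun _ _ _ => id) (fun c => by
        have := card_sameType_le (Set.univ : Set P) h₀ (l₁ := e.1) (l₂ := e.2) A
          (fun p hp => by simpa using hAsub hp) c
        rw [hAcard] at this
        have hov : ∀ c : P → Fin k, overlay Set.univ h₀ c = c := by
          intro c; funext p; simp [overlay]
        simp only [hov] at this
        convert this)
    rw [hAcard] at key
    simpa using key
  have hdouble := Finset.sum_card_bipartiteAbove_eq_sum_card_bipartiteBelow
    (s := (univ : Finset (P → Fin k))) (t := O) (fun c e => lineType c e.1 = lineType c e.2)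
  simp only [bipartiteAbove, bipartiteBelow] at hdouble
  have htwo : ∀ c ∈ (univ : Finset (P → Fin k)),
      2 ≤ #{e ∈ O | lineType c e.1 = lineType c e.2} := by
    intro c _
    have := hcon c
    unfold IsLegitimate at this
    push Not at this
    obtain ⟨l₁, l₂, hne, heq⟩ := this
    have hsub : ({(l₁, l₂), (l₂, l₁)} : Finset (L × L))
        ⊆ ({e ∈ O | lineType c e.1 = lineType c e.2} : Finset (L × L)) := by
      intro e he
      simp only [mem_insert, mem_singleton] at he
      rcases he with rfl | rfl
      · simp [hO, hne, heq]
      · simp [hO, hne.symm, heq]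
    refine le_trans (le_of_eq ?_) (card_le_card hsub)
    rw [card_pair]
    simp [hne]
  have h1 := Finset.card_nsmul_le_sum _ _ _ htwo
  rw [hdouble, card_univ, Fintype.card_fun, Fintype.card_fin, smul_eq_mul] at h1
  have h2 : (k : ℝ) ^ Fintype.card P * 2
      ≤ ∑ e ∈ O, (#{c : P → Fin k | lineType c e.1 = lineType c e.2} : ℝ) := by
    exact_mod_cast h1
  have hOcard : (#O : ℝ) = linePairs n := by
    rw [hO, offDiag_card, card_univ, ProjectivePlane.card_lines P L, hn]
    have : (n ^ 2 + n + 1) * (n ^ 2 + n + 1) - (n ^ 2 + n + 1)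
        = (n ^ 2 + n + 1) * (n ^ 2 + n) := by
      rw [← Nat.mul_sub_one]; rfl
    rw [this, linePairs]
    push_cast
    ring
  have hK : (0 : ℝ) < (k : ℝ) ^ Fintype.card P := by positivity
  have h3 : (k : ℝ) ^ Fintype.card P * 2 * (k : ℝ) ^ n
      ≤ linePairs n * (typeBound k n * (k : ℝ) ^ Fintype.card P) := by
    calc _ ≤ (∑ e ∈ O, (#{c : P → Fin k | lineType c e.1 = lineType c e.2} : ℝ)) * (k : ℝ) ^ n := by
          gcongr
      _ ≤ ∑ e ∈ O, typeBound k n * (k : ℝ) ^ Fintype.card P := by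
          rw [Finset.sum_mul]
          exact sum_le_sum hbad
      _ = _ := by rw [sum_const, nsmul_eq_mul, hOcard]
  nlinarith [mul_lt_mul_of_pos_right h hK]

end Plane

lemma second_moment_bound {n d s N Q : ℝ} (hn : 0 ≤ n) (hs : 0 ≤ s) (hsN : s ≤ N) (hd : d ≤ 11)
    (hQ : s ^ 2 ≤ Q) : 2 * n * (d * s * N - Q) ≤ 20 * n * N ^ 2 := by
  have h1 : d * (s * N) ≤ 11 * (s * N) :=
    mul_le_mul_of_nonneg_right hd (mul_nonneg hs (hs.trans hsN))
  have h2 : d * s * N - Q ≤ 10 * N ^ 2 := by nlinarith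
  nlinarith [mul_le_mul_of_nonneg_left h2 hn]

section SecondMoment

open Finset Classical

variable {P L : Type*} [Membership P L] [Fintype P] [Fintype L] [ProjectivePlane P L]

lemma sum_card_inter_line {n : ℕ} (hn : ProjectivePlane.order P L = n) (C : Finset P) :
    ∑ l : L, (#{p ∈ C | p ∈ l} : ℝ) = #C * (n + 1) := by
  have h := Finset.sum_card_bipartiteAbove_eq_sum_card_bipartiteBelow
    (s := C) (t := (univ : Finset L)) (fun p l => p ∈ l)
  simp only [bipartiteAbove, bipartiteBelow, card_linesThrough, hn, sum_const, smul_eq_mul] at h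
  exact_mod_cast h.symm

lemma sum_card_inter_line_sq {n : ℕ} (hn : ProjectivePlane.order P L = n) (C : Finset P) :
    ∑ l : L, (#{p ∈ C | p ∈ l} : ℝ) ^ 2 = #C * (#C + n) := by
  have h := Finset.sum_card_bipartiteAbove_eq_sum_card_bipartiteBelow
    (s := C ×ˢ C) (t := (univ : Finset L)) (fun p l => p.1 ∈ l ∧ p.2 ∈ l)
  simp only [bipartiteAbove, bipartiteBelow] at h
  have h1 : ∀ l : L, #{p ∈ C ×ˢ C | p.1 ∈ l ∧ p.2 ∈ l} = #{p ∈ C | p ∈ l} ^ 2 := by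
    intro l
    rw [Finset.filter_product (fun p => p ∈ l) (fun p => p ∈ l), card_product, sq]
  have h2 : ∀ p ∈ C, ∑ q ∈ C, #{l : L | p ∈ l ∧ q ∈ l} = #C + n := by
    intro p hp
    rw [← Finset.add_sum_erase _ _ hp]
    have : ∑ q ∈ C.erase p, #{l : L | p ∈ l ∧ q ∈ l} = ∑ q ∈ C.erase p, 1 :=
      sum_congr rfl fun q hq => card_linesThrough_two (ne_of_mem_erase hq).symm
    rw [this]
    simp only [and_self, card_linesThrough, hn, sum_const, smul_eq_mul, mul_one]
    rw [← card_erase_add_one hp]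
    omega
  simp only [h1] at h
  rw [sum_product, sum_congr rfl h2, sum_const, smul_eq_mul] at h
  exact_mod_cast h.symm

lemma sum_sq_sub_card_inter_line {n : ℕ} (hn : ProjectivePlane.order P L = n) (C : Finset P) :
    ∑ l : L, ∑ l' : L, ((#{p ∈ C | p ∈ l} : ℝ) - #{p ∈ C | p ∈ l'}) ^ 2
      = 2 * n * #C * ((n : ℝ) ^ 2 + n + 1 - #C) := by
  have h1 := sum_card_inter_line hn C
  have h2 := sum_card_inter_line_sq hn C
  have h3 : (Fintype.card L : ℝ) = (n : ℝ) ^ 2 + n + 1 := by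
    rw [ProjectivePlane.card_lines P L, hn]; push_cast; ring
  simp only [sub_sq, sum_add_distrib, sum_sub_distrib, sum_const, card_univ, nsmul_eq_mul,
    ← Finset.mul_sum, ← Finset.sum_mul, h1, h2, h3]
  ring

variable {S : Set P} {d : ℕ} (f : {p : P // p ∉ S} → Fin d)

/-- The points of colour `i`. -/
noncomputable def colourClass (i : Fin d) : Finset P := {p : P | ∃ h : p ∉ S, f ⟨p, h⟩ = i}

omit [Fintype L] [ProjectivePlane P L] in
lemma partialLineType_eq_card (l : L) (i : Fin d) :
    partialLineType f l i = #{p ∈ colourClass f i | p ∈ l} := by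
  rw [partialLineType, ← Set.ncard_image_of_injective _ Subtype.val_injective,
    ← Set.ncard_coe_finset]
  congr 1
  ext p
  simp only [colourClass, Set.mem_image, Set.mem_ofPred_eq, Subtype.exists, exists_and_right,
    exists_eq_right, coe_filter, mem_filter, mem_univ, true_and]
  exact ⟨fun ⟨h, h1, h2⟩ => ⟨⟨h, h2⟩, h1⟩, fun ⟨⟨h, h2⟩, h1⟩ => ⟨h, h1, h2⟩⟩

omit [Membership P L] [Fintype L] [ProjectivePlane P L] in
lemma sum_card_colourClass_le (Q : P → Prop) :
    ∑ i, #{p ∈ colourClass f i | Q p} ≤ #{p : P | p ∉ S ∧ Q p} := by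
  rw [← card_biUnion]
  · refine card_le_card fun p hp => ?_
    simp only [colourClass, mem_biUnion, mem_filter, mem_univ, true_and] at hp ⊢
    obtain ⟨i, ⟨h, -⟩, hQ⟩ := hp
    exact ⟨h, hQ⟩
  · intro i _ j _ hij
    rw [Function.onFun, Finset.disjoint_left]
    intro p hp hp'
    simp only [colourClass, mem_filter, mem_univ, true_and] at hp hp'
    obtain ⟨⟨h, hi⟩, -⟩ := hp
    obtain ⟨⟨h', hj⟩, -⟩ := hp'
    exact hij (hi.symm.trans hj)

omit [Membership P L] [Fintype L] [ProjectivePlane P L] in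
lemma sum_card_colourClass_le_card : ∑ i, #(colourClass f i) ≤ Fintype.card P := by
  refine le_trans (le_of_eq ?_) ((sum_card_colourClass_le f fun _ => True).trans (card_le_univ _))
  refine sum_congr rfl fun i _ => ?_
  congr 1
  ext p
  simp only [mem_filter, and_true]

/-- The `ℓ¹`-distance of the types of two lines. -/
noncomputable def typeDist (l₁ l₂ : L) : ℝ :=
  ∑ i, |(partialLineType f l₁ i : ℝ) - (partialLineType f l₂ i : ℝ)|

lemma sum_typeDist_sq_le {n : ℕ} (hn : ProjectivePlane.order P L = n) (hd : d ≤ 11) :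
    ∑ l : L, ∑ l' : L, typeDist f l l' ^ 2 ≤ 20 * n * ((n : ℝ) ^ 2 + n + 1) ^ 2 := by
  set N : ℝ := (n : ℝ) ^ 2 + n + 1 with hN
  set s : ℝ := ∑ i, (#(colourClass f i) : ℝ) with hs
  have hs0 : 0 ≤ s := sum_nonneg fun i _ => Nat.cast_nonneg _
  have hsN : s ≤ N := by
    have h2 := sum_card_colourClass_le_card f
    rw [ProjectivePlane.card_points P L, hn] at h2
    have h3 : ((∑ i, #(colourClass f i) : ℕ) : ℝ) ≤ ((n ^ 2 + n + 1 : ℕ) : ℝ) := by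
      exact_mod_cast h2
    push_cast at h3
    exact h3
  have hd' : (d : ℝ) ≤ 11 := by exact_mod_cast hd
  have hsq : s ^ 2 ≤ d * ∑ i, (#(colourClass f i) : ℝ) ^ 2 := by
    have := sq_sum_le_card_mul_sum_sq (s := univ) (f := fun i => (#(colourClass f i) : ℝ))
    simpa using this
  have h1 : ∀ l l' : L, typeDist f l l' ^ 2 ≤ d * ∑ i,
      ((#{p ∈ colourClass f i | p ∈ l} : ℝ) - #{p ∈ colourClass f i | p ∈ l'}) ^ 2 := by
    intro l l'
    have := sq_sum_le_card_mul_sum_sq (s := univ)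
      (f := fun i => |(partialLineType f l i : ℝ) - (partialLineType f l' i : ℝ)|)
    simpa only [typeDist, sq_abs, partialLineType_eq_card, card_univ, Fintype.card_fin] using this
  calc ∑ l : L, ∑ l' : L, typeDist f l l' ^ 2
      ≤ ∑ l : L, ∑ l' : L, d * ∑ i,
        ((#{p ∈ colourClass f i | p ∈ l} : ℝ) - #{p ∈ colourClass f i | p ∈ l'}) ^ 2 :=
        sum_le_sum fun l _ => sum_le_sum fun l' _ => h1 l l'
    _ = d * ∑ i, ∑ l : L, ∑ l' : L,
        ((#{p ∈ colourClass f i | p ∈ l} : ℝ) - #{p ∈ colourClass f i | p ∈ l'}) ^ 2 := by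
        simp only [← Finset.mul_sum]
        congr 1
        rw [Finset.sum_comm (s := (univ : Finset (Fin d)))]
        refine sum_congr rfl fun l _ => ?_
        rw [Finset.sum_comm]
    _ = d * ∑ i, (2 * n * #(colourClass f i) * (N - #(colourClass f i))) := by
        simp only [sum_sq_sub_card_inter_line hn, hN]
    _ = 2 * n * (d * s * N - d * ∑ i, (#(colourClass f i) : ℝ) ^ 2) := by
        have : ∀ i, 2 * (n : ℝ) * #(colourClass f i) * (N - #(colourClass f i))
            = 2 * n * N * #(colourClass f i) - 2 * n * (#(colourClass f i) : ℝ) ^ 2 :=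
          fun i => by ring
        simp only [this, sum_sub_distrib, ← Finset.mul_sum, ← hs]
        ring
    _ ≤ _ := second_moment_bound (Nat.cast_nonneg n) hs0 hsN hd' hsq

lemma le_sum_typeDist_sq {n D : ℕ} (hn : ProjectivePlane.order P L = n)
    (hD : ∀ l : L, #{l' : L | IsDangerousPair n f l l'} ≤ D) :
    ((n : ℝ) ^ 2 + n + 1) * ((n : ℝ) ^ 2 + n - D) * (22 * Real.log n) ^ 2
      ≤ ∑ l : L, ∑ l' : L, typeDist f l l' ^ 2 := by
  have hL : Fintype.card L = n ^ 2 + n + 1 := by rw [ProjectivePlane.card_lines P L, hn]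
  have hlog : 0 ≤ Real.log n := Real.log_natCast_nonneg n
  have h1 : ∀ l : L, ((n : ℝ) ^ 2 + n - D) * (22 * Real.log n) ^ 2
      ≤ ∑ l' : L, typeDist f l l' ^ 2 := by
    intro l
    set T : Finset L := {l' : L | l ≠ l' ∧ ¬ IsDangerousPair n f l l'} with hT
    set W : Finset L := {l' : L | IsDangerousPair n f l l'} with hW
    have hcard : n ^ 2 + n + 1 ≤ #T + D + 1 := by
      have : (univ : Finset L) ⊆ T ∪ W ∪ {l} := by
        intro l' _
        simp only [hT, hW, mem_union, mem_filter, mem_univ, true_and, mem_singleton]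
        by_cases hl : l' = l
        · exact Or.inr hl
        · left; by_cases hd : IsDangerousPair n f l l'
          · exact Or.inr hd
          · exact Or.inl ⟨fun h => hl h.symm, hd⟩
      have h2 := card_le_card this
      rw [card_univ, hL] at h2
      have h3 := card_union_le (T ∪ W) {l}
      have h4 := card_union_le T W
      have h5 : #W ≤ D := hD l
      rw [card_singleton] at h3
      omega
    have hcard' : (n : ℝ) ^ 2 + n - D ≤ #T := by
      have : ((n ^ 2 + n + 1 : ℕ) : ℝ) ≤ ((#T + D + 1 : ℕ) : ℝ) := by exact_mod_cast hcard
      push_cast at this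
      linarith
    calc ((n : ℝ) ^ 2 + n - D) * (22 * Real.log n) ^ 2 ≤ #T * (22 * Real.log n) ^ 2 := by gcongr
      _ = ∑ l' ∈ T, (22 * Real.log n) ^ 2 := by rw [sum_const, nsmul_eq_mul]
      _ ≤ ∑ l' ∈ T, typeDist f l l' ^ 2 := by
          refine sum_le_sum fun l' hl' => ?_
          simp only [hT, mem_filter, mem_univ, true_and, IsDangerousPair, not_and, not_le] at hl'
          have := hl'.2 hl'.1
          unfold typeDist
          gcongr
      _ ≤ _ := sum_le_sum_of_subset_of_nonneg (subset_univ _) fun _ _ _ => by positivity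
  calc _ = ∑ l : L, ((n : ℝ) ^ 2 + n - D) * (22 * Real.log n) ^ 2 := by
        rw [sum_const, nsmul_eq_mul, card_univ, hL]; push_cast; ring
    _ ≤ _ := sum_le_sum fun l _ => h1 l

omit [Fintype P] [ProjectivePlane P L] in
lemma card_le_of_dangerous {n D : ℕ} {p : P} (hp : (dangerousPairsAt L n f p).ncard ≤ D)
    (T : Finset (L × L)) (hT : ∀ e ∈ T, IsDangerousPair n f e.1 e.2 ∧ p ∈ e.1)
    (hinj : Set.InjOn (fun e : L × L => s(e.1, e.2)) T) : #T ≤ D := by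
  refine le_trans ?_ hp
  rw [← Set.ncard_coe_finset]
  refine Set.ncard_le_ncard_of_injOn _ (fun e he => ?_) hinj (Set.toFinite _)
  exact ⟨e.1, e.2, rfl, (hT e he).1, Or.inl (hT e he).2⟩

omit [Fintype P] [ProjectivePlane P L] in
lemma card_dangerous_partners_le {n D : ℕ} {p : P} {l : L} (hpl : p ∈ l)
    (hp : (dangerousPairsAt L n f p).ncard ≤ D) :
    #{l' : L | IsDangerousPair n f l l'} ≤ D := by
  rw [← card_map (Function.Embedding.sectR l L)]
  refine card_le_of_dangerous f hp _ (fun e he => ?_) ?_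
  · simp only [mem_map, mem_filter, mem_univ, true_and] at he
    obtain ⟨l', hl', rfl⟩ := he
    exact ⟨hl', hpl⟩
  · intro e he e' he' heq
    simp only [coe_map, Set.mem_image, coe_filter, mem_univ, true_and, Set.mem_ofPred_eq] at he he'
    obtain ⟨l', -, rfl⟩ := he
    obtain ⟨l'', -, rfl⟩ := he'
    simp only [Function.Embedding.sectR_apply, Sym2.eq_iff, true_and] at heq ⊢
    rcases heq with rfl | ⟨rfl, rfl⟩ <;> rfl

lemma le_of_forall_dangerous {n D : ℕ} (hn : ProjectivePlane.order P L = n) {p : P}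
    (hp : (dangerousPairsAt L n f p).ncard ≤ D)
    (hall : ∀ l l' : L, l ≠ l' → IsDangerousPair n f l l') : (n + 1) * n ^ 2 ≤ D := by
  have hcard : #{l : L | p ∉ l} = n ^ 2 := by
    have h := card_filter_add_card_filter_not (s := (univ : Finset L)) (fun l => p ∈ l)
    rw [card_linesThrough, card_univ, ProjectivePlane.card_lines P L, hn] at h
    omega
  have := card_le_of_dangerous f hp (({l : L | p ∈ l} : Finset L) ×ˢ ({l : L | p ∉ l} : Finset L))
    (fun e he => by
      simp only [mem_product, mem_filter, mem_univ, true_and] at he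
      exact ⟨hall _ _ fun h => he.2 (h ▸ he.1), he.1⟩) (by
      rintro ⟨l₁, l₂⟩ he ⟨l₁', l₂'⟩ he' heq
      simp only [coe_product, coe_filter, mem_univ, true_and, Set.mem_prod,
        Set.mem_ofPred_eq] at he he'
      simp only [Sym2.eq_iff] at heq
      rcases heq with ⟨rfl, rfl⟩ | ⟨rfl, rfl⟩
      · rfl
      · exact absurd he.1 he'.2)
  rwa [card_product, card_linesThrough, hn, hcard] at this

end SecondMoment

lemma mul_log_two_le_log {n : ℕ} (j : ℕ) (h : 2 ^ j ≤ n) : j * Real.log 2 ≤ Real.log n := by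
  rw [← Real.log_pow]
  exact Real.log_le_log (by positivity) (by exact_mod_cast h)

lemma le_eleven_mul_log {n : ℕ} (h2 : 2 ≤ n) (h30 : n ≤ 30) : (n : ℝ) ≤ 11 * Real.log n := by
  have hl := Real.log_two_gt_d9
  rcases lt_or_ge n 8 with h | h
  · have h1 := mul_log_two_le_log 1 (n := n) (by omega)
    have : (n : ℝ) ≤ 7 := by exact_mod_cast Nat.le_of_lt_succ h
    push_cast at h1
    linarith
  rcases lt_or_ge n 16 with h' | h'
  · have h1 := mul_log_two_le_log 3 (n := n) (by omega)
    have : (n : ℝ) ≤ 15 := by exact_mod_cast Nat.le_of_lt_succ h'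
    push_cast at h1
    linarith
  · have h1 := mul_log_two_le_log 4 (n := n) (by omega)
    have : (n : ℝ) ≤ 30 := by exact_mod_cast h30
    push_cast at h1
    linarith

lemma second_moment_lt_aux {x ℓ : ℝ} (lo hi c : ℝ) (hlo : lo ≤ x) (hhi : x ≤ hi) (hc : c ≤ ℓ)
    (hc0 : 0 ≤ c) (hlo0 : 0 ≤ lo) (hpos : 282 ≤ lo ^ 2 + lo + 1) (hslope : 20 * hi ≤ (22 * c) ^ 2)
    (h : 20 * hi * (lo ^ 2 + lo + 1) < (lo ^ 2 + lo + 1 - 282) * (22 * c) ^ 2) :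
    20 * x * (x ^ 2 + x + 1) ^ 2 < (x ^ 2 + x + 1) * (x ^ 2 + x - 281) * (22 * ℓ) ^ 2 := by
  have hN : lo ^ 2 + lo + 1 ≤ x ^ 2 + x + 1 := by gcongr
  have hsq : (22 * c) ^ 2 ≤ (22 * ℓ) ^ 2 := by gcongr
  set N := x ^ 2 + x + 1 with hNdef
  have h1 : 20 * hi * N < (N - 282) * (22 * c) ^ 2 := by
    nlinarith [mul_nonneg (sub_nonneg.mpr hslope) (sub_nonneg.mpr hN)]
  have h2 : (N - 282) * (22 * c) ^ 2 ≤ (N - 282) * (22 * ℓ) ^ 2 :=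
    mul_le_mul_of_nonneg_left hsq (by linarith)
  have hN0 : 0 < N := by linarith
  have h3 : 20 * x * N ≤ 20 * hi * N := by gcongr
  have h4 : x ^ 2 + x - 281 = N - 282 := by rw [hNdef]; ring
  rw [h4]
  have h5 : 20 * x * N < (N - 282) * (22 * ℓ) ^ 2 := by linarith
  calc 20 * x * N ^ 2 = N * (20 * x * N) := by ring
    _ < N * ((N - 282) * (22 * ℓ) ^ 2) := mul_lt_mul_of_pos_left h5 hN0
    _ = _ := by ring

lemma second_moment_lt {n : ℕ} (h31 : 31 ≤ n) (h1096 : n ≤ 1096) :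
    20 * (n : ℝ) * ((n : ℝ) ^ 2 + n + 1) ^ 2
      < ((n : ℝ) ^ 2 + n + 1) * ((n : ℝ) ^ 2 + n - 281) * (22 * Real.log n) ^ 2 := by
  have hl := Real.log_two_gt_d9
  rcases lt_or_ge n 128 with h | h
  · have h1 := mul_log_two_le_log 4 (n := n) (by omega)
    push_cast at h1
    exact second_moment_lt_aux 31 127 2.772 (by exact_mod_cast h31)
      (by exact_mod_cast Nat.le_of_lt_succ h) (by linarith) (by norm_num) (by norm_num)
      (by norm_num) (by norm_num) (by norm_num)
  rcases lt_or_ge n 512 with h' | h'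
  · have h1 := mul_log_two_le_log 7 (n := n) (by omega)
    push_cast at h1
    exact second_moment_lt_aux 128 511 4.851 (by exact_mod_cast h)
      (by exact_mod_cast Nat.le_of_lt_succ h') (by linarith) (by norm_num) (by norm_num)
      (by norm_num) (by norm_num) (by norm_num)
  clear h
  rcases lt_or_ge n 768 with h | h
  · have h1 := mul_log_two_le_log 9 (n := n) (by omega)
    push_cast at h1
    exact second_moment_lt_aux 512 767 6.237 (by exact_mod_cast h')
      (by exact_mod_cast Nat.le_of_lt_succ h) (by linarith) (by norm_num) (by norm_num)
      (by norm_num) (by norm_num) (by norm_num)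
  clear h'
  rcases lt_or_ge n 1024 with h' | h'
  · have h1 := mul_log_two_le_log 19 (n := n ^ 2) (by nlinarith)
    push_cast at h1
    rw [Real.log_pow] at h1
    push_cast at h1
    exact second_moment_lt_aux 768 1023 6.584 (by exact_mod_cast h)
      (by exact_mod_cast Nat.le_of_lt_succ h') (by linarith) (by norm_num) (by norm_num)
      (by norm_num) (by norm_num) (by norm_num)
  · have h1 := mul_log_two_le_log 10 (n := n) (by omega)
    push_cast at h1
    exact second_moment_lt_aux 1024 1096 6.931 (by exact_mod_cast h')
      (by exact_mod_cast h1096) (by linarith) (by norm_num) (by norm_num)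
      (by norm_num) (by norm_num) (by norm_num)

lemma seven_lt_log {n : ℕ} (h : 1097 ≤ n) : (7 : ℝ) < Real.log n := by
  have hn : (1097 : ℝ) ≤ n := by exact_mod_cast h
  rw [Real.lt_log_iff_exp_lt (by linarith)]
  refine lt_of_lt_of_le ?_ hn
  have h1 := Real.exp_one_lt_d9
  have : Real.exp 7 = Real.exp 1 ^ 7 := by rw [← Real.exp_nat_mul]; norm_num
  rw [this]
  calc Real.exp 1 ^ 7 < 2.7182818286 ^ 7 := by gcongr
    _ < 1097 := by norm_num

section Main

open Finset Classical

lemma lineType_eq_add {P L : Type*} [Membership P L] [Fintype P] {k : ℕ} (g : P → Fin k)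
    (l₁ l₂ : L) (i : Fin k) : lineType g l₁ i
      = #{p : P | p ∈ l₁ ∧ p ∉ l₂ ∧ g p = i} + #{p : P | p ∈ l₁ ∧ p ∈ l₂ ∧ g p = i} := by
  rw [lineType_eq_card, ← card_union_of_disjoint]
  · congr 1
    ext p
    simp only [mem_filter, mem_univ, true_and, mem_union]
    tauto
  · rw [Finset.disjoint_left]
    intro p hp hp'
    simp only [mem_filter, mem_univ, true_and] at hp hp'
    exact hp.2.1 hp'.2.1

lemma lineType_eq_iff {P L : Type*} [Membership P L] [Fintype P] {k : ℕ} (g : P → Fin k)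
    (l₁ l₂ : L) : lineType g l₁ = lineType g l₂ ↔ ∀ i,
      #{p : P | p ∈ l₁ ∧ p ∉ l₂ ∧ g p = i} = #{p : P | p ∈ l₂ ∧ p ∉ l₁ ∧ g p = i} := by
  rw [funext_iff]
  refine forall_congr' fun i => ?_
  rw [lineType_eq_add g l₁ l₂ i, lineType_eq_add g l₂ l₁ i]
  have : #{p : P | p ∈ l₁ ∧ p ∈ l₂ ∧ g p = i} = #{p : P | p ∈ l₂ ∧ p ∈ l₁ ∧ g p = i} := by
    congr 1
    ext p
    simp only [mem_filter, mem_univ, true_and]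
    tauto
  omega

lemma ncard_inter_eq_card {P L : Type*} [Membership P L] [Fintype P] (S : Set P) (l : L) :
    {p : P | p ∈ l ∧ p ∈ S}.ncard = #{p : P | p ∈ S ∧ p ∈ l} := by
  rw [Set.ncard_eq_toFinset_card', Set.toFinset_ofPred]
  simp only [and_comm]

lemma IsDangerousPair.symm {P L : Type*} [Membership P L] {n d : ℕ} {S : Set P}
    {f : {p : P // p ∉ S} → Fin d} {l₁ l₂ : L} (h : IsDangerousPair n f l₁ l₂) :
    IsDangerousPair n f l₂ l₁ := by
  refine ⟨h.1.symm, ?_⟩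
  simp only [abs_sub_comm (partialLineType f l₂ _ : ℝ)]
  exact h.2

/-- Two lines which have the same type under a colouring that extends `f` have types at distance
at most `22 ln n` under `f`. -/
lemma typeDist_le_of_lineType_eq {P L : Type*} [Membership P L] [Fintype P] {n d k : ℕ}
    {S : Set P} (hS : IsBalancedSet L n S) (f : {p : P // p ∉ S} → Fin d) (hdk : d ≤ k)
    (g : P → Fin k) (hg : ∀ p : {p : P // p ∉ S}, g p = Fin.castLE hdk (f p)) {l₁ l₂ : L}
    (h : lineType g l₁ = lineType g l₂) : typeDist f l₁ l₂ ≤ 22 * Real.log n := by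
  set s : L → Fin d → ℕ := fun l i => #{p : P | (p ∈ S ∧ p ∈ l) ∧ g p = Fin.castLE hdk i} with hs
  have hsplit : ∀ l i, lineType g l (Fin.castLE hdk i) = partialLineType f l i + s l i := by
    intro l i
    rw [lineType_eq_card, partialLineType_eq_card, hs, ← card_union_of_disjoint]
    · congr 1
      ext p
      simp only [colourClass, mem_filter, mem_univ, true_and, mem_union]
      by_cases hp : p ∈ S
      · simp [hp]
      · have := hg ⟨p, hp⟩
        simp only at this
        simp [hp, this, and_comm]
    · rw [Finset.disjoint_left]
      intro p hp hp'
      simp only [colourClass, mem_filter, mem_univ, true_and] at hp hp'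
      exact hp.1.1 hp'.1.1
  have hsum : ∀ l, ∑ i, (s l i : ℝ) ≤ 11 * Real.log n := by
    intro l
    refine le_trans ?_ (hS l).2
    rw [ncard_inter_eq_card]
    norm_cast
    simp only [hs]
    rw [← card_biUnion]
    · refine card_le_card fun p hp => ?_
      simp only [mem_biUnion, mem_filter, mem_univ, true_and] at hp ⊢
      exact hp.choose_spec.1
    · intro i _ j _ hij
      rw [Function.onFun, Finset.disjoint_left]
      intro p hp hp'
      simp only [mem_filter, mem_univ, true_and] at hp hp'
      exact hij (Fin.castLE_injective hdk (hp.2.symm.trans hp'.2))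
  calc typeDist f l₁ l₂ ≤ ∑ i, ((s l₁ i : ℝ) + s l₂ i) := by
        refine sum_le_sum fun i _ => ?_
        have h1 := congrFun h (Fin.castLE hdk i)
        rw [hsplit, hsplit] at h1
        have h2 : (partialLineType f l₁ i : ℝ) + s l₁ i = partialLineType f l₂ i + s l₂ i := by
          exact_mod_cast h1
        have h3 : (0 : ℝ) ≤ s l₁ i := Nat.cast_nonneg _
        have h4 : (0 : ℝ) ≤ s l₂ i := Nat.cast_nonneg _
        rw [abs_le]
        constructor <;> linarith
    _ ≤ _ := by
        rw [sum_add_distrib]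
        linarith [hsum l₁, hsum l₂]

variable {P L : Type*} [Membership P L] [Fintype P] [Fintype L] [ProjectivePlane P L]

lemma isDangerousPair_of_le {n d : ℕ} (hn : ProjectivePlane.order P L = n) {S : Set P}
    (hS : ∀ l : L, ∃ p ∈ S, p ∈ l) (f : {p : P // p ∉ S} → Fin d)
    (hlog : (n : ℝ) ≤ 11 * Real.log n) {l₁ l₂ : L} (hne : l₁ ≠ l₂) :
    IsDangerousPair n f l₁ l₂ := by
  have h1 : ∀ l : L, ∑ i, (partialLineType f l i : ℝ) ≤ n := by
    intro l
    norm_cast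
    simp only [partialLineType_eq_card]
    refine (sum_card_colourClass_le f fun p => p ∈ l).trans ?_
    have h2 : #{p : P | p ∉ S ∧ p ∈ l} < #{p : P | p ∈ l} := by
      refine card_lt_card ⟨fun p hp => ?_, fun hsub => ?_⟩
      · simp only [mem_filter, mem_univ, true_and] at hp ⊢
        exact hp.2
      · obtain ⟨p, hpS, hpl⟩ := hS l
        have := hsub (mem_filter.mpr ⟨mem_univ p, hpl⟩)
        simp only [mem_filter, mem_univ, true_and] at this
        exact this.1 hpS
    rw [card_pointsOn, hn] at h2
    omega
  refine ⟨hne, ?_⟩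
  calc ∑ i, |(partialLineType f l₁ i : ℝ) - (partialLineType f l₂ i : ℝ)|
      ≤ ∑ i, ((partialLineType f l₁ i : ℝ) + partialLineType f l₂ i) := by
        refine sum_le_sum fun i _ => ?_
        have h3 : (0 : ℝ) ≤ partialLineType f l₁ i := Nat.cast_nonneg _
        have h4 : (0 : ℝ) ≤ partialLineType f l₂ i := Nat.cast_nonneg _
        rw [abs_le]
        constructor <;> linarith
    _ ≤ _ := by
        rw [sum_add_distrib]
        linarith [h1 l₁, h1 l₂]

lemma EntropyCond.add_div_pow_le {k D m : ℕ} (hk : 0 < k) (hm : 1 ≤ m)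
    (h : EntropyCond k D (m + 1)) :
    (m : ℝ) * k / (m + 1) + D * (m + 1).factorial / ((m : ℝ) * k / (m + 1)) ^ m ≤ k := by
  unfold EntropyCond at h
  push_cast at h
  rw [add_sub_cancel_right, pow_succ] at h
  have hm' : (0 : ℝ) < m := by exact_mod_cast hm
  have hk' : (0 : ℝ) < k := by exact_mod_cast hk
  have h1 : (D : ℝ) * (m + 1).factorial / ((m : ℝ) * k / (m + 1)) ^ m ≤ k / (m + 1) := by
    rw [div_le_iff₀ (by positivity)]
    refine le_of_mul_le_mul_right (h.trans (le_of_eq ?_)) hm'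
    field_simp
  calc _ ≤ (m : ℝ) * k / (m + 1) + k / (m + 1) := add_le_add_right h1 _
    _ = k := by field_simp

theorem exists_isLegitimate_of_entropyCond {n d k D m : ℕ} {S : Set P}
    (hS : IsBalancedSet L n S) (f : {p : P // p ∉ S} → Fin d)
    (hf : ∀ p ∈ S, (dangerousPairsAt L n f p).ncard ≤ D) (hdk : d ≤ k) (hk : 0 < k) (hm : 1 ≤ m)
    (hcard : ∀ l : L, m + 2 ≤ #{p : P | p ∈ S ∧ p ∈ l}) (hcond : EntropyCond k D (m + 1)) :
    ∃ f : P → Fin k, IsLegitimate L f := by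
  set h : P → Fin k := fun p => if hp : p ∈ S then ⟨0, hk⟩ else Fin.castLE hdk (f ⟨p, hp⟩)
  set Bad : Sym2 L → (P → Fin k) → Prop := fun e c => ∃ l₁ l₂ : L, e = s(l₁, l₂) ∧
    IsDangerousPair n f l₁ l₂ ∧ lineType (overlay S h c) l₁ = lineType (overlay S h c) l₂ with hBad
  set U : Sym2 L → Finset P := fun e => {p : P | p ∈ S ∧ ∃ l₁ l₂ : L, e = s(l₁, l₂) ∧
    IsDangerousPair n f l₁ l₂ ∧ p ∈ l₁ ∧ p ∉ l₂} with hU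
  have hm' : (0 : ℝ) < m := by exact_mod_cast hm
  have hk' : (0 : ℝ) < k := by exact_mod_cast hk
  have hdiff : ∀ l₁ l₂ : L, l₁ ≠ l₂ → m + 1 ≤ #{p : P | p ∈ S ∧ p ∈ l₁ ∧ p ∉ l₂} := by
    intro l₁ l₂ hne
    have := card_sub_one_le_card_diff S hne
    have := hcard l₁
    omega
  obtain ⟨c, hc⟩ := exists_colouring_avoiding (U := U) (Bad := Bad) (D := D) (m := m)
    (β := (m : ℝ) * k / (m + 1)) (B := ((m + 1).factorial : ℝ)) (by positivity) (by positivity)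
    (by
      rintro e c c' hcc ⟨l₁, l₂, rfl, hd, heq⟩
      refine ⟨l₁, l₂, rfl, hd, ?_⟩
      rw [lineType_eq_iff] at heq ⊢
      have hov : ∀ p, p ∈ U s(l₁, l₂) ∨ p ∉ S → overlay S h c p = overlay S h c' p := by
        intro p hp
        by_cases hpS : p ∈ S
        · simp only [overlay, hpS, if_true]
          exact hcc p (hp.resolve_right fun h => h hpS)
        · simp only [overlay, hpS, if_false]
      intro i
      have h1 : #{p : P | p ∈ l₁ ∧ p ∉ l₂ ∧ overlay S h c' p = i}
          = #{p : P | p ∈ l₁ ∧ p ∉ l₂ ∧ overlay S h c p = i} := by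
        congr 1
        refine filter_congr fun p _ => and_congr_right fun hp1 => and_congr_right fun hp2 => ?_
        rw [hov p]
        by_cases hpS : p ∈ S
        · left
          simp only [hU, mem_filter, mem_univ, true_and]
          exact ⟨hpS, l₁, l₂, rfl, hd, hp1, hp2⟩
        · exact Or.inr hpS
      have h2 : #{p : P | p ∈ l₂ ∧ p ∉ l₁ ∧ overlay S h c' p = i}
          = #{p : P | p ∈ l₂ ∧ p ∉ l₁ ∧ overlay S h c p = i} := by
        congr 1
        refine filter_congr fun p _ => and_congr_right fun hp1 => and_congr_right fun hp2 => ?_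
        rw [hov p]
        by_cases hpS : p ∈ S
        · left
          simp only [hU, mem_filter, mem_univ, true_and]
          exact ⟨hpS, l₂, l₁, Sym2.eq_swap, hd.symm, hp1, hp2⟩
        · exact Or.inr hpS
      rw [h1, h2, heq i])
    (by
      intro p
      by_cases hpS : p ∈ S
      · refine le_trans ?_ (hf p hpS)
        rw [← Set.ncard_coe_finset]
        refine Set.ncard_le_ncard (fun e he => ?_) (Set.toFinite _)
        simp only [hU, coe_filter, mem_filter, mem_univ, true_and, Set.mem_ofPred_eq] at he
        obtain ⟨-, l₁, l₂, he, hd, hp, -⟩ := he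
        exact ⟨l₁, l₂, he, hd, Or.inl hp⟩
      · rw [filter_false_of_mem]
        · exact Nat.zero_le _
        · intro e _ he
          simp only [hU, mem_filter, mem_univ, true_and] at he
          exact hpS he.1)
    (by
      intro e p hp
      simp only [hU, mem_filter, mem_univ, true_and] at hp
      obtain ⟨hpS, l₁, l₂, rfl, hd, hp1, hp2⟩ := hp
      obtain ⟨A, hpA, hAsub, hAcard⟩ := Finset.exists_subsuperset_card_eq
        (s := {p}) (t := ({p : P | p ∈ S ∧ p ∈ l₁ ∧ p ∉ l₂} : Finset P)) (n := m + 1)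
        (by simp [hpS, hp1, hp2]) (by simp) (hdiff l₁ l₂ hd.1)
      have hA : ∀ q ∈ A, q ∈ S ∧ q ∈ l₁ ∧ q ∉ l₂ := fun q hq => by simpa using hAsub hq
      refine ⟨A, fun q hq => ?_, hpA (mem_singleton_self p), hAcard, fun c => ?_⟩
      · simp only [hU, mem_filter, mem_univ, true_and]
        exact ⟨(hA q hq).1, l₁, l₂, rfl, hd, (hA q hq).2⟩
      · have h1 := (card_sameType_le S h A hA c).trans (typeBound_le_factorial k #A)
        rw [hAcard] at h1
        refine le_trans ?_ h1
        norm_cast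
        refine card_le_card fun c' hc' => ?_
        simp only [hBad, mem_filter, mem_univ, true_and] at hc' ⊢
        obtain ⟨hoff, l₁', l₂', he, -, heq⟩ := hc'
        refine ⟨hoff, ?_⟩
        rcases Sym2.eq_iff.mp he with ⟨rfl, rfl⟩ | ⟨rfl, rfl⟩
        · exact heq
        · exact heq.symm)
    (hcond.add_div_pow_le hk hm)
    (by
      rintro e c ⟨l₁, l₂, rfl, hd, -⟩
      have : 0 < #{p : P | p ∈ S ∧ p ∈ l₁ ∧ p ∉ l₂} := by
        have := hdiff l₁ l₂ hd.1
        omega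
      obtain ⟨p, hp⟩ := card_pos.mp this
      simp only [mem_filter, mem_univ, true_and] at hp
      refine ⟨p, ?_⟩
      simp only [hU, mem_filter, mem_univ, true_and]
      exact ⟨hp.1, l₁, l₂, rfl, hd, hp.2⟩)
  refine ⟨overlay S h c, fun l₁ l₂ hne heq => hc s(l₁, l₂) ⟨l₁, l₂, rfl, ⟨hne, ?_⟩, heq⟩⟩
  refine typeDist_le_of_lineType_eq hS f hdk (overlay S h c) (fun p => ?_) heq
  simp only [overlay, h, p.2, if_false, dif_neg, not_false_eq_true]

/-- In a plane of order at most `1096` there are too many dangerous pairs for a number of colours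
that is too small for a random colouring to be legitimate. -/
lemma exists_isLegitimate_of_small {n d k D : ℕ} (hn : ProjectivePlane.order P L = n)
    (hn1 : n ≤ 1096) {S : Set P} (hS : ∀ l : L, ∃ p ∈ S, p ∈ l) (f : {p : P // p ∉ S} → Fin d)
    (hf : ∀ p ∈ S, (dangerousPairsAt L n f p).ncard ≤ D) (hdk : d ≤ k) {m : ℕ} (hm : 2 ≤ m)
    (hcond : EntropyCond k D m) : ∃ f : P → Fin k, IsLegitimate L f := by
  have hn2 : 2 ≤ n := hn ▸ ProjectivePlane.one_lt_order P L
  obtain ⟨-, -, -, l₀, -⟩ := ProjectivePlane.exists_config (P := P) (L := L)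
  obtain ⟨p₀, hp₀, hpl₀⟩ := hS l₀
  have hdense : n ≤ 30 → (n + 1) * n ^ 2 ≤ D := fun h30 =>
    le_of_forall_dangerous f hn (hf p₀ hp₀) fun l l' hne =>
      isDangerousPair_of_le hn hS f (le_eleven_mul_log hn2 h30) hne
  have reduce : ∀ k₀, 0 < k₀ → k₀ ≤ k → linePairs n * typeBound k₀ n < 2 * (k₀ : ℝ) ^ n →
      ∃ f : P → Fin k, IsLegitimate L f := by
    intro k₀ h0 hle hlt
    obtain ⟨g, hg⟩ := exists_isLegitimate_of_linePairs_lt hn h0 hlt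
    exact ⟨_, hg.castLE hle⟩
  rcases lt_or_ge n 7 with h7 | h7
  · have hD := hdense (by omega)
    have h8 : 8 ≤ k := by
      by_contra! hk
      have := EntropyCond.lt_of_seven hm (hcond.mono hm (by omega))
      nlinarith
    have h9 : 3 ≤ n → 9 ≤ k := by
      intro hn3
      by_contra! hk
      have := EntropyCond.lt_of_eight hm (hcond.mono hm (by omega))
      have : 3 ^ 2 ≤ n ^ 2 := Nat.pow_le_pow_left hn3 2
      nlinarith
    have h10 : 4 ≤ n → 10 ≤ k := by
      intro hn4
      by_contra! hk
      have := EntropyCond.lt_of_nine hm (hcond.mono hm (by omega))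
      have : 4 ^ 2 ≤ n ^ 2 := Nat.pow_le_pow_left hn4 2
      nlinarith
    have h11 : 5 ≤ n → 11 ≤ k := by
      intro hn5
      by_contra! hk
      have := EntropyCond.lt_of_ten hm (hcond.mono hm (by omega))
      have : 5 ^ 2 ≤ n ^ 2 := Nat.pow_le_pow_left hn5 2
      nlinarith
    obtain rfl | rfl | rfl | rfl | rfl : n = 2 ∨ n = 3 ∨ n = 4 ∨ n = 5 ∨ n = 6 := by omega
    · exact reduce 8 (by norm_num) h8
        (by norm_num [linePairs, typeBound, Finset.prod_range_succ])
    · exact reduce 9 (by norm_num) (h9 (by norm_num))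
        (by norm_num [linePairs, typeBound, Finset.prod_range_succ])
    · exact reduce 10 (by norm_num) (h10 (by norm_num))
        (by norm_num [linePairs, typeBound, Finset.prod_range_succ])
    · exact reduce 11 (by norm_num) (h11 (by norm_num))
        (by norm_num [linePairs, typeBound, Finset.prod_range_succ])
    · exact reduce 11 (by norm_num) (h11 (by norm_num))
        (by norm_num [linePairs, typeBound, Finset.prod_range_succ])
  · refine reduce 12 (by norm_num) ?_ (by exact_mod_cast linePairs_mul_typeBound_twelve_lt h7)
    by_contra! hk
    have hD := EntropyCond.lt_of_eleven hm (hcond.mono hm (by omega))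
    rcases le_or_gt n 30 with h30 | h30
    · have := hdense h30
      have : 7 ^ 2 ≤ n ^ 2 := Nat.pow_le_pow_left h7 2
      nlinarith
    · have h1 := le_sum_typeDist_sq f (D := 281) hn fun l => by
        obtain ⟨p, hp, hpl⟩ := hS l
        exact (card_dangerous_partners_le f hpl (hf p hp)).trans (by omega)
      have h2 := sum_typeDist_sq_le f hn (by omega)
      have h3 := second_moment_lt h30 hn1
      push_cast at h1
      linarith

lemma exists_isLegitimate_of_large {n d k D : ℕ} (hn : ProjectivePlane.order P L = n)
    (hn1 : 1097 ≤ n) {S : Set P} (hS : IsBalancedSet L n S) (f : {p : P // p ∉ S} → Fin d)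
    (hf : ∀ p ∈ S, (dangerousPairsAt L n f p).ncard ≤ D) (hdk : d ≤ k) {m : ℕ} (hm : 2 ≤ m)
    (hcond : EntropyCond k D m) : ∃ f : P → Fin k, IsLegitimate L f := by
  have hlog := seven_lt_log hn1
  have hcard : ∀ l : L, 8 ≤ #{p : P | p ∈ S ∧ p ∈ l} := by
    intro l
    have := (hS l).1
    rw [ncard_inter_eq_card] at this
    exact_mod_cast hlog.trans_le this
  rcases lt_or_ge k 10 with hk | hk
  · obtain ⟨m', hm2, hm7, hcond'⟩ := hcond.exists_le (m₀ := 7) (by norm_num) (by omega) hm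
    obtain ⟨m, rfl⟩ : ∃ j, m' = j + 1 := ⟨m' - 1, by omega⟩
    refine exists_isLegitimate_of_entropyCond hS f hf hdk ?_ (by omega)
      (fun l => le_trans (by omega) (hcard l)) hcond'
    by_contra! hk0
    obtain rfl : k = 0 := by omega
    obtain rfl : d = 0 := by omega
    obtain ⟨-, -, -, l₀, -⟩ := ProjectivePlane.exists_config (P := P) (L := L)
    obtain ⟨p, hp⟩ := card_pos.mp (lt_of_lt_of_le (by norm_num) (hcard l₀))
    simp only [mem_filter, mem_univ, true_and] at hp
    have hD := le_of_forall_dangerous f hn (hf p hp.1) fun l l' hne =>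
      ⟨hne, by
        rw [Finset.univ_eq_empty, sum_empty]
        linarith⟩
    have := EntropyCond.lt_of_seven hm (hcond.mono hm (by norm_num))
    nlinarith
  · obtain ⟨g, hg⟩ := exists_isLegitimate_of_linePairs_lt hn (k := 10) (by norm_num)
      (by exact_mod_cast linePairs_mul_typeBound_ten_lt (n := n) (by omega))
    exact ⟨_, hg.castLE hk⟩

end Main

theorem mainTheorem2 {P L : Type*} [Membership P L] [Finite P] [Finite L]
    [ProjectivePlane P L] (n : ℕ) (hn : ProjectivePlane.order P L = n)
    (S : Set P) (hS : IsBalancedSet L n S) (a b d : ℕ) (hd : ColorsSuffice L n S a b d) :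
    ∃ f : P → Fin (max d ⌈entropyBound a b⌉₊), IsLegitimate L f := by
  cases nonempty_fintype P
  cases nonempty_fintype L
  obtain ⟨f, hf⟩ := hd
  obtain ⟨m, hm, hcond⟩ := exists_entropyCond (le_max_right d ⌈entropyBound a b⌉₊)
  rcases le_or_gt n 1096 with h | h
  · refine exists_isLegitimate_of_small hn h (fun l => ?_) f hf (le_max_left _ _) hm hcond
    have h2 : 1 < n := hn ▸ ProjectivePlane.one_lt_order P L
    have hpos : 0 < Real.log n := Real.log_pos (by exact_mod_cast h2)
    have h3 : (0 : ℝ) < ({p : P | p ∈ l ∧ p ∈ S}.ncard : ℝ) := hpos.trans_le (hS l).1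
    obtain ⟨p, hpl, hpS⟩ := Set.nonempty_of_ncard_ne_zero (by exact_mod_cast h3.ne')
    exact ⟨p, hpS, hpl⟩
  · exact exists_isLegitimate_of_large hn h hS f hf (le_max_left _ _) hm hcond
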